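/- Let $n\ge 0$ and let $\mathfrak S_n$ be the symmetric group on $\{1,\dots,n\}$; write $\sigma\in\mathfrak S_n$ as the word $\sigma(1)\sigma(2)\cdots\sigma(n)$. **Words.** For a word $w=y_1\cdots y_l$ of nonnegative integers let $\mathrm{DES}\,w=\{i: 1\le i\le l-1,\ y_i>y_{i+1}\}$ and $\mathrm{maj}\,w=\sum_{i\in \mathrm{DES}\,w} i$. For a finite set $A$ of integers, $\mathrm{red}$ denotes the increasing bijection $A\to\{1,\dots,\#A\}$. **Classical statistics.** For $\sigma\in\mathfrak S_n$ let $\mathrm{FIX}\,\sigma=\{i:\sigma(i)=i\}$, $\mathrm{fix}\,\sigma=\#\mathrm{FIX}\,\sigma$, $\mathrm{IDES}\,\sigma=\mathrm{DES}\,\sigma^{-1}$, $\mathrm{imaj}\,\sigma=\mathrm{maj}\,\sigma^{-1}$, and $\mathrm{inv}\,\sigma=\#\{(i,j):1\le i<j\le n,\ \sigma(i)>\sigma(j)\}$. **Fixed decomposition.** Let $j_1<\dots<j_m$ be the non-fixed points of $\sigma$ and let $\mathrm{red}$ be the increasing bijection of $\{j_1,\dots,j_m\}$ onto $\{1,\dots,m\}$.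 Let $\mathrm{ZDer}\,\sigma$ be the word obtained from $\sigma(1)\cdots\sigma(n)$ by replacing each fixed point by $0$ and each other letter $\sigma(j_k)$ by $\mathrm{red}\,\sigma(j_k)$, and let $\mathrm{Der}\,\sigma=\mathrm{red}\,\sigma(j_1)\cdots\mathrm{red}\,\sigma(j_m)$. Put $$\mathrm{DEZ}\,\sigma=\mathrm{DES}(\mathrm{ZDer}\,\sigma),\qquad \mathrm{maz}\,\sigma=\mathrm{maj}(\mathrm{ZDer}\,\sigma),\qquad \mathrm{maf}\,\sigma=\sum_{i\in\mathrm{FIX}\,\sigma}i-\sum_{i=1}^{\mathrm{fix}\,\sigma}i+\mathrm{maj}(\mathrm{Der}\,\sigma).$$ **Pixed decomposition.** A word $y_1\cdots y_l$ without repeated letters is a *desarrangement* if, with $y_{l+1}=\infty$, there is an integer $k$ with $1\le k\le l/2$ such that $y_1>y_2>\cdots>y_{2k}$ and $y_{2k}<y_{2k+1}$. Write $\sigma=\sigma^p\sigma^d$, where $\sigma^d$ is the longest right factor of $\sigma(1)\cdots\sigma(n)$ that is a desarrangement ($\sigma^d$ is empty if there is none). Let $\mathrm{PIX}\,\sigma$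 and $\mathrm{pix}\,\sigma$ be the set and the number of the letters of $\sigma^p$. Let $m=n-\mathrm{pix}\,\sigma$, let $\mathrm{red}$ be the increasing bijection of the set of letters of $\sigma^d$ onto $\{1,\dots,m\}$, and let $\mathrm{Desar}\,\sigma\in\mathfrak S_m$ be the permutation whose word is $\mathrm{red}\,\sigma(n-m+1)\cdots\mathrm{red}\,\sigma(n)$. Put $$\mathrm{mag}\,\sigma=\sum_{i\in\mathrm{PIX}\,\sigma}i-\sum_{i=1}^{\mathrm{pix}\,\sigma}i+\mathrm{imaj}(\mathrm{Desar}\,\sigma).$$ Two statistics $f,g$ on $\mathfrak S_n$ are *equidistributed* if $\#\{\sigma\in\mathfrak S_n: f(\sigma)=v\}=\#\{\sigma\in\mathfrak S_n: g(\sigma)=v\}$ for every value $v$. **Theorem 1.2.** In each of the following four groups, the pairs of statistics are equidistributed on $\mathfrak S_n$: 1. $(\mathrm{fix},\mathrm{maj})$, $(\mathrm{fix},\mathrm{maf})$, $(\mathrm{fix},\mathrm{maz})$, $(\mathrm{pix},\mathrm{mag})$, $(\mathrm{pix},\mathrm{inv})$, $(\mathrm{pix},\mathrm{imaj})$; 2.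 $(\mathrm{FIX},\mathrm{maf})$, $(\mathrm{PIX},\mathrm{mag})$, $(\mathrm{PIX},\mathrm{inv})$; 3. $(\mathrm{fix},\mathrm{DEZ})$, $(\mathrm{fix},\mathrm{DES})$, $(\mathrm{pix},\mathrm{IDES})$; 4. $(\mathrm{FIX},\mathrm{DEZ})$, $(\mathrm{PIX},\mathrm{IDES})$. -/

import Mathlib

open scoped Finset

namespace FixMahonian

/-! ### Statistics on words with nonnegative letters (positions are numbered from 1) -/

/-- The descent set of a word `y₁ ⋯ yₗ`: all `i` with `1 ≤ i ≤ l - 1` and `yᵢ > yᵢ₊₁`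
(the letter `yᵢ` is stored at index `i - 1`). -/
def wordDES (w : List ℕ) : Finset ℕ :=
  {i ∈ Finset.Ico 1 w.length | w.getD i 0 < w.getD (i - 1) 0}

/-- The major index of a word: the sum of its descents. -/
def wordMaj (w : List ℕ) : ℕ := ∑ i ∈ wordDES w, i

/-- For `x ∈ A`, the rank of `x` in `A`; on `A` this is the increasing bijection of `A` onto
`{1, …, #A}`. -/
def red (A : Finset ℕ) (x : ℕ) : ℕ := #{a ∈ A | a ≤ x}

/-- For a word `w` that is a rearrangement of `1 2 ⋯ m`, the word of the inverse permutation: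
its `v`-th letter is the position of the letter `v` in `w`. -/
def wordInverse (w : List ℕ) : List ℕ :=
  (List.range' 1 w.length).map fun v => w.idxOf v + 1

/-! ### Classical statistics on permutations -/

variable {n : ℕ}

/-- The linear representation `σ(1) σ(2) ⋯ σ(n)`, with letters in `{1, …, n}`. -/
def word (σ : Equiv.Perm (Fin n)) : List ℕ := List.ofFn fun i => (σ i : ℕ) + 1

/-- The set of fixed points, as a subset of `{1, …, n}`. -/
def FIX (σ : Equiv.Perm (Fin n)) : Finset ℕ :=
  Finset.image (fun i : Fin n => (i : ℕ) + 1) {i | σ i = i}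

/-- The number of fixed points. -/
def fix (σ : Equiv.Perm (Fin n)) : ℕ := #(FIX σ)

/-- The descent set. -/
def DES (σ : Equiv.Perm (Fin n)) : Finset ℕ := wordDES (word σ)

/-- The idescent set: the descent set of the inverse. -/
def IDES (σ : Equiv.Perm (Fin n)) : Finset ℕ := DES σ⁻¹

/-- The major index. -/
def maj (σ : Equiv.Perm (Fin n)) : ℕ := ∑ i ∈ DES σ, i

/-- The inverse major index. -/
def imaj (σ : Equiv.Perm (Fin n)) : ℕ := ∑ i ∈ IDES σ, i

/-- The number of inversions. -/
def inv (σ : Equiv.Perm (Fin n)) : ℕ := #{p : Fin n × Fin n | p.1 < p.2 ∧ σ p.2 < σ p.1}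

/-! ### The fixed decomposition -/

/-- The set `{j₁ < ⋯ < jₘ}` of non-fixed points; `σ` permutes it, so it is also the set of the
letters `σ(j₁), …, σ(jₘ)`. -/
def nonFIX (σ : Equiv.Perm (Fin n)) : Finset ℕ := Finset.Icc 1 n \ FIX σ

/-- The word obtained from `σ(1) ⋯ σ(n)` by replacing each fixed point by `0` and each other
letter by its reduction. -/
def ZDer (σ : Equiv.Perm (Fin n)) : List ℕ :=
  List.ofFn fun i => if σ i = i then 0 else red (nonFIX σ) ((σ i : ℕ) + 1)

/-- The word `red σ(j₁) ⋯ red σ(jₘ)`. -/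
def Der (σ : Equiv.Perm (Fin n)) : List ℕ :=
  ((List.finRange n).filter fun i => σ i ≠ i).map fun i => red (nonFIX σ) ((σ i : ℕ) + 1)

def DEZ (σ : Equiv.Perm (Fin n)) : Finset ℕ := wordDES (ZDer σ)

def maz (σ : Equiv.Perm (Fin n)) : ℕ := wordMaj (ZDer σ)

/-- For a set `{i₁ < ⋯ < iₖ}` of positive integers,
`(i₁ + ⋯ + iₖ) - (1 + ⋯ + k) = (i₁ - 1) + ⋯ + (iₖ - k)`. -/
def excess (A : Finset ℕ) : ℕ := ∑ i ∈ A, i - ∑ k ∈ Finset.Icc 1 #A, k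

/-- The subtraction in `excess` never truncates. -/
theorem sum_Icc_card_le_sum (A : Finset ℕ) (hA : 0 ∉ A) :
    ∑ k ∈ Finset.Icc 1 #A, k ≤ ∑ i ∈ A, i := by
  induction A using Finset.induction_on_max with
  | empty => simp
  | insert a s hs ih =>
    have ha : a ∉ s := fun h => lt_irrefl _ (hs a h)
    have h0 : 0 ∉ s := fun h => hA (Finset.mem_insert_of_mem h)
    have ha0 : a ≠ 0 := fun h => hA (h ▸ Finset.mem_insert_self a s)
    have hc : #s + 1 ≤ a := by
      have hsub : s ⊆ Finset.Ico 1 a := fun x hx => by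
        have hx0 : x ≠ 0 := fun h => h0 (h ▸ hx)
        exact Finset.mem_Ico.2 ⟨Nat.one_le_iff_ne_zero.2 hx0, hs x hx⟩
      have := Finset.card_le_card hsub
      rw [Nat.card_Ico] at this
      omega
    rw [Finset.card_insert_of_notMem ha, Finset.sum_insert ha,
      Finset.sum_Icc_succ_top (by omega)]
    have := ih h0
    omega

def maf (σ : Equiv.Perm (Fin n)) : ℕ := excess (FIX σ) + wordMaj (Der σ)

/-! ### The pixed decomposition -/

/-- A word `y₁ ⋯ yₗ` without repetitions is a desarrangement if `y₁ > y₂ > ⋯ > y₂ₖ` and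
`y₂ₖ < y₂ₖ₊₁` for some `k ≥ 1` (with `2k ≤ l`), where `yₗ₊₁ = ∞`. -/
def IsDesarrangement (w : List ℕ) : Prop :=
  ∃ k ≤ w.length / 2, 1 ≤ k ∧ (w.take (2 * k)).Pairwise (· > ·) ∧
    (2 * k < w.length → w.getD (2 * k - 1) 0 < w.getD (2 * k) 0)

instance : DecidablePred IsDesarrangement := fun w => by
  unfold IsDesarrangement; infer_instance

/-- The longest right factor of `w` that is a desarrangement (empty if there is none). -/
def longestDesarrangement : List ℕ → List ℕ
  | [] => []
  | y :: w => if IsDesarrangement (y :: w) then y :: w else longestDesarrangement w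

/-- The right factor `σᵈ` of the pixed factorization `σ = σᵖ σᵈ`. -/
def pixedRight (σ : Equiv.Perm (Fin n)) : List ℕ := longestDesarrangement (word σ)

/-- The left factor `σᵖ` of the pixed factorization `σ = σᵖ σᵈ`. -/
def pixedLeft (σ : Equiv.Perm (Fin n)) : List ℕ := (word σ).take (n - (pixedRight σ).length)

/-- The set of the letters of `σᵖ`. -/
def PIX (σ : Equiv.Perm (Fin n)) : Finset ℕ := (pixedLeft σ).toFinset

/-- The number of letters of `σᵖ`. -/
def pix (σ : Equiv.Perm (Fin n)) : ℕ := #(PIX σ)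

/-- The word `red σ(n-m+1) ⋯ red σ(n)`, where `σᵈ = σ(n-m+1) ⋯ σ(n)`. -/
def Desar (σ : Equiv.Perm (Fin n)) : List ℕ :=
  (pixedRight σ).map (red (pixedRight σ).toFinset)

def mag (σ : Equiv.Perm (Fin n)) : ℕ := excess (PIX σ) + wordMaj (wordInverse (Desar σ))

/-! ### Equidistribution -/

/-- Two statistics on the symmetric group take each value equally often. -/
def Equidistributed {α : Type} [DecidableEq α] (f g : Equiv.Perm (Fin n) → α) : Prop :=
  ∀ v, #{σ | f σ = v} = #{σ | g σ = v}

end FixMahonian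

open FixMahonian

/-!
# Equidistribution of fixed-point and pixed-point statistics

The fixed decomposition splits `σ` into its set of fixed points and a derangement of `m` letters,
the pixed decomposition splits it into a set of letters and a desarrangement of `m` letters. All
statistics of the theorem are functions of these two pieces: `DEZ` is the same function
`insertDES` of `FIX` and `DES (Der σ)` as `IDES` is of `PIX` and `IDES (Desar σ)`
(`DEZ_eq_insertDES`, `IDES_eq_insertDES`), and `inv σ = excess (PIX σ) + inv (Desar σ)`
(`inv_eq_excess_add`). Since the pieces are independent (`card_FIX_eq`, `card_PIX_eq`),
everything follows from two facts about the symmetric group: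

* `(fix, DES)` and `(pix, IDES)` are equidistributed (`card_fix_DES_eq_card_pix_IDES`);
* `(inv, DES)` and `(imaj, DES)` are equidistributed (`card_inv_DES_eq_card_imaj_DES`), which
  applies to desarrangements because `pix` is a function of `DES`.

By inclusion-exclusion it is enough to count the permutations with `DES σ ⊆ J`. Cutting the
positions into blocks at `J`, such a `σ` is the same as a word `w` with a letter multiset
determined by `J`, whose standardization is `σ⁻¹` (`card_DES_subset`). Then `inv σ` and `imaj σ`
are the inversion number and the major index of `w`, and the second fact is MacMahon's theorem,
proved by Foata's second fundamental transformation (`card_wordMaj_eq_card_wordInv`).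

For the first fact, `fix σ` is the number of letters `x` of `w` having as many letters `≠ x` on
their left as there are letters `< x` in `w`. A letter `a` can be inserted as such a fixed letter
in exactly one way, and this does not change the other ones (`card_fixedLetters_cons`). In the
same way a letter can be inserted into the increasing left factor of the pixed factorization of a
word (`card_pixedLetters_cons`). Hence the multisets of fixed letters and of pixed letters have
distributions on rearrangement classes that obey the same recursion, with the same initial data:
the nonempty multisets reduce to shorter words, and the empty one is what remains of the whole
class (`card_eq_of_cons`).
-/

namespace FixMahonian

/-! ### MacMahon's theorem: the major index and the inversion number on rearrangement classes -/

/-- The words with letter multiset `c`. -/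
def arrangements (c : Multiset ℕ) : Finset (List ℕ) := c.lists.toFinset

@[simp]
theorem mem_arrangements {c : Multiset ℕ} {w : List ℕ} :
    w ∈ arrangements c ↔ (w : Multiset ℕ) = c := by
  simp [arrangements, eq_comm]

/-- The number of inversions of a word. -/
def wordInv : List ℕ → ℕ
  | [] => 0
  | x :: t => t.countP (· < x) + wordInv t

/-- The number of inversions of the reversed word. -/
def revInv : List ℕ → ℕ
  | [] => 0
  | x :: t => t.countP (x < ·) + revInv t

/-- The major index of the reversed word. -/
def revMaj : List ℕ → ℕ
  | [] => 0
  | [_] => 0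
  | x :: y :: t => (if x < y then t.length + 1 else 0) + revMaj (y :: t)

/-- The letters of `y :: t` satisfying `P` (where `y` does) cut it into blocks, each starting
with such a letter; the first letter of each block is moved to the end of the block. -/
def carry (P : ℕ → Prop) [DecidablePred P] (y : ℕ) : List ℕ → List ℕ
  | [] => [y]
  | z :: t => if P z then y :: carry P z t else z :: carry P y t

section carry

variable {P : ℕ → Prop} [DecidablePred P]

theorem carry_perm (y : ℕ) (t : List ℕ) : (carry P y t).Perm (y :: t) := by
  induction t generalizing y with
  | nil => simp [carry]
  | cons z t ih =>
    simp only [carry]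
    split_ifs
    · exact (ih z).cons y
    · exact ((ih y).cons z).trans (List.Perm.swap y z t)

theorem length_carry (y : ℕ) (t : List ℕ) : (carry P y t).length = t.length + 1 := by
  simpa using (carry_perm (P := P) y t).length_eq

theorem carry_injective {y y' : ℕ} {t t' : List ℕ} (hy : P y) (hy' : P y')
    (h : carry P y t = carry P y' t') : y = y' ∧ t = t' := by
  induction t generalizing y y' t' with
  | nil =>
    have := congrArg List.length h
    simp only [length_carry, List.length_nil] at this
    obtain rfl : t' = [] := List.length_eq_zero_iff.1 (by omega)
    simpa [carry] using h
  | cons z t ih =>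
    have hl := congrArg List.length h
    simp only [length_carry, List.length_cons] at hl
    obtain - | ⟨z', t'⟩ := t'
    · simp at hl
    · simp only [carry] at h
      split_ifs at h with h1 h2 h2 <;> simp only [List.cons.injEq] at h
      · obtain ⟨rfl, h⟩ := h
        obtain ⟨rfl, rfl⟩ := ih h1 h2 h
        simp
      · exact absurd (h.1 ▸ hy) h2
      · exact absurd (h.1 ▸ hy') h1
      · obtain ⟨rfl, h⟩ := h
        obtain ⟨rfl, rfl⟩ := ih hy hy' h
        simp

end carry

theorem revInv_carry_le (x : ℕ) {y : ℕ} (hy : y ≤ x) (t : List ℕ) :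
    revInv (carry (· ≤ x) y t) + t.countP (x < ·) = revInv (y :: t) := by
  induction t generalizing y with
  | nil => simp [carry, revInv]
  | cons z t ih =>
    by_cases hz : z ≤ x
    · have h := ih hz
      have hc := (carry_perm (P := (· ≤ x)) z t).countP_eq (y < ·)
      simp only [carry, hz, if_true, revInv, List.countP_cons, hc, decide_eq_true_eq, hz.not_gt,
        if_false] at h ⊢
      omega
    · have h := ih hy
      have hc := (carry_perm (P := (· ≤ x)) y t).countP_eq (z < ·)
      have h1 : y < z := by omega
      have h2 : x < z := by omega
      simp only [carry, hz, if_false, revInv, List.countP_cons, hc, decide_eq_true_eq, h1, h2,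
        h1.not_gt, if_true] at h ⊢
      omega

theorem revInv_carry_gt (x : ℕ) {y : ℕ} (hy : x < y) (t : List ℕ) :
    revInv (carry (x < ·) y t) = revInv (y :: t) + t.countP (· ≤ x) := by
  induction t generalizing y with
  | nil => simp [carry, revInv]
  | cons z t ih =>
    by_cases hz : x < z
    · have h := ih hz
      have hc := (carry_perm (P := (x < ·)) z t).countP_eq (y < ·)
      simp only [carry, hz, if_true, revInv, List.countP_cons, hc, decide_eq_true_eq, hz.not_ge,
        if_false] at h ⊢
      omega
    · have h := ih hy
      have hc := (carry_perm (P := (x < ·)) y t).countP_eq (z < ·)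
      have h1 : z < y := by omega
      have h2 : z ≤ x := by omega
      simp only [carry, hz, if_false, revInv, List.countP_cons, hc, decide_eq_true_eq, h1, h2,
        h1.not_gt, if_true] at h ⊢
      omega

/-- The step `γₓ` of Foata's second fundamental transformation, on reversed words. -/
def foataStep (x : ℕ) : List ℕ → List ℕ
  | [] => []
  | y :: t => if y ≤ x then carry (· ≤ x) y t else carry (x < ·) y t

theorem foataStep_perm (x : ℕ) (t : List ℕ) : (foataStep x t).Perm t := by
  cases t with
  | nil => simp [foataStep]
  | cons y t =>
    simp only [foataStep]
    split_ifs <;> exact carry_perm y t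

theorem getLast?_carry {P : ℕ → Prop} [DecidablePred P] {y : ℕ} (hy : P y) (t : List ℕ) :
    ∃ z, P z ∧ (carry P y t).getLast? = some z := by
  induction t generalizing y with
  | nil => exact ⟨y, hy, by simp [carry]⟩
  | cons z t ih =>
    simp only [carry]
    split_ifs with h
    · obtain ⟨u, hu, h'⟩ := ih h
      exact ⟨u, hu, by simp [List.getLast?_cons, h']⟩
    · obtain ⟨u, hu, h'⟩ := ih hy
      exact ⟨u, hu, by simp [List.getLast?_cons, h']⟩

theorem foataStep_injective (x : ℕ) : Function.Injective (foataStep x) := by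
  intro t t' h
  have hl := congrArg List.length h
  rw [(foataStep_perm x t).length_eq, (foataStep_perm x t').length_eq] at hl
  obtain - | ⟨y, t⟩ := t <;> obtain - | ⟨y', t'⟩ := t'
  · rfl
  · simp at hl
  · simp at hl
  · simp only [foataStep] at h
    -- the last letter of the image tells which of the two cuttings was used
    split_ifs at h with h1 h2 h2
    · simpa using carry_injective (P := (· ≤ x)) h1 h2 h
    · obtain ⟨u, hu, e⟩ := getLast?_carry (P := (· ≤ x)) h1 t
      obtain ⟨v, hv, e'⟩ := getLast?_carry (P := (x < ·)) (not_le.1 h2) t'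
      rw [h, e', Option.some.injEq] at e
      omega
    · obtain ⟨u, hu, e⟩ := getLast?_carry (P := (x < ·)) (not_le.1 h1) t
      obtain ⟨v, hv, e'⟩ := getLast?_carry (P := (· ≤ x)) h2 t'
      rw [h, e', Option.some.injEq] at e
      omega
    · simpa using carry_injective (P := (x < ·)) (not_le.1 h1) (not_le.1 h2) h

/-- Foata's second fundamental transformation, on reversed words. -/
def foata : List ℕ → List ℕ
  | [] => []
  | x :: t => x :: foataStep x (foata t)

theorem foata_perm (w : List ℕ) : (foata w).Perm w := by
  induction w with
  | nil => simp [foata]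
  | cons x t ih => exact ((foataStep_perm x _).trans ih).cons x

theorem foata_injective : Function.Injective foata := by
  intro w w' h
  induction w generalizing w' with
  | nil => cases w' <;> simp_all [foata]
  | cons x t ih =>
    obtain - | ⟨x', t'⟩ := w'
    · simp [foata] at h
    · simp only [foata, List.cons.injEq] at h
      obtain ⟨rfl, h⟩ := h
      rw [ih (foataStep_injective x h)]

theorem revInv_foata (w : List ℕ) : revInv (foata w) = revMaj w := by
  induction w with
  | nil => rfl
  | cons x t ih =>
    obtain - | ⟨y, t⟩ := t
    · simp [foata, foataStep, revInv, revMaj]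
    · have hl := (foata_perm (y :: t)).length_eq
      have hp := (foataStep_perm x (foata (y :: t))).countP_eq (x < ·)
      rw [foata, revInv, revMaj, hp, ← ih]
      rw [show foata (y :: t) = y :: foataStep y (foata t) from rfl] at hl ⊢
      generalize foataStep y (foata t) = s at hl ⊢
      simp only [List.length_cons, foataStep, List.countP_cons] at hl ⊢
      by_cases h : y ≤ x
      · simp only [h, not_lt.2 h, decide_false, if_true, if_false, ← revInv_carry_le x h]
        simp
        omega
      · have := List.length_eq_countP_add_countP (fun z => decide (x < z)) (l := s)
        simp only [not_lt, decide_eq_true_eq] at this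
        simp only [h, not_le.1 h, decide_true, if_true, if_false,
          revInv_carry_gt x (not_le.1 h)]
        omega

theorem card_arrangements_reverse (c : Multiset ℕ) (f g : List ℕ → ℕ)
    (h : ∀ w, f w.reverse = g w) (k : ℕ) :
    #{w ∈ arrangements c | f w = k} = #{w ∈ arrangements c | g w = k} := by
  refine Finset.card_nbij' List.reverse List.reverse ?_ ?_ ?_ ?_ <;>
    intro w hw <;> simp at hw ⊢
  · exact ⟨hw.1, by rw [← h, List.reverse_reverse]; exact hw.2⟩
  · exact ⟨hw.1, by rw [h]; exact hw.2⟩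

theorem mem_wordDES {w : List ℕ} {i : ℕ} :
    i ∈ wordDES w ↔ (1 ≤ i ∧ i < w.length) ∧ w.getD i 0 < w.getD (i - 1) 0 := by
  simp [wordDES]

theorem wordMaj_concat_concat (w : List ℕ) (y x : ℕ) :
    wordMaj (w ++ [y] ++ [x]) = wordMaj (w ++ [y]) + if x < y then w.length + 1 else 0 := by
  have : wordDES (w ++ [y] ++ [x]) =
      wordDES (w ++ [y]) ∪ if x < y then {w.length + 1} else ∅ := by
    ext i
    have hx : (w ++ [y] ++ [x]).getD (w.length + 1) 0 = x := by simp
    have hy : (w ++ [y] ++ [x]).getD w.length 0 = y := by simp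
    rw [Finset.mem_union, mem_wordDES, mem_wordDES]
    rcases lt_trichotomy i (w.length + 1) with h | rfl | h
    · rw [List.getD_append _ _ _ i (by simpa using h),
        List.getD_append _ _ _ (i - 1) (by simp; omega)]
      split_ifs <;> simp <;> omega
    · simp only [Nat.add_sub_cancel, hx, hy]
      split_ifs <;> simp [*]
    · split_ifs <;> simp <;> omega
  rw [wordMaj, this, Finset.sum_union]
  · split_ifs <;> simp [wordMaj]
  · split_ifs <;> simp [mem_wordDES]

theorem wordMaj_reverse (w : List ℕ) : wordMaj w.reverse = revMaj w := by
  induction w with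
  | nil => rfl
  | cons x t ih =>
    obtain - | ⟨y, t⟩ := t
    · rfl
    · rw [List.reverse_cons, List.reverse_cons, wordMaj_concat_concat, ← List.reverse_cons, ih,
        revMaj, List.length_reverse, add_comm]

theorem wordInv_append (u v : List ℕ) :
    wordInv (u ++ v) = wordInv u + wordInv v + (u.map fun x => v.countP (· < x)).sum := by
  induction u with
  | nil => simp [wordInv]
  | cons x u ih => simp [wordInv, ih]; omega

theorem wordInv_reverse (w : List ℕ) : wordInv w.reverse = revInv w := by
  induction w with
  | nil => rfl
  | cons x t ih =>
    have h : ∀ u : List ℕ,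
        (u.map fun y => [x].countP (· < y)).sum = u.countP (x < ·) := by
      intro u
      induction u with
      | nil => rfl
      | cons y u ih =>
        rw [List.map_cons, List.sum_cons, ih, List.countP_cons, add_comm]
        simp [List.countP_cons]
    rw [List.reverse_cons, wordInv_append, ih, h, List.countP_reverse, revInv]
    simp [wordInv, add_comm]

/-- MacMahon's theorem. -/
theorem card_wordMaj_eq_card_wordInv (c : Multiset ℕ) (k : ℕ) :
    #{w ∈ arrangements c | wordMaj w = k} = #{w ∈ arrangements c | wordInv w = k} := by
  rw [card_arrangements_reverse c wordMaj revMaj wordMaj_reverse,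
    card_arrangements_reverse c wordInv revInv wordInv_reverse]
  have hmap : ∀ w, foata w ∈ arrangements c ↔ w ∈ arrangements c := fun w => by
    rw [mem_arrangements, mem_arrangements, Multiset.coe_eq_coe.2 (foata_perm w)]
  have himg : (arrangements c).image foata = arrangements c :=
    Finset.eq_of_subset_of_card_le
      (Finset.image_subset_iff.2 fun w hw => (hmap w).2 hw)
      (Finset.card_image_of_injective _ foata_injective).ge
  conv_rhs => rw [← himg, Finset.filter_image, Finset.card_image_of_injective _ foata_injective]
  simp only [revInv_foata]

/-! ### Fixed letters of a word -/

/-- The fixed letters of the factor `v` of a word `u v ⋯` with letter multiset `c`: an occurrence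
of `x` is fixed if the number of letters `≠ x` on its left is the number of letters `< x` in the
whole word. -/
def fixedLettersAux (c u : Multiset ℕ) : List ℕ → Multiset ℕ
  | [] => 0
  | x :: v => (if u.countP (· ≠ x) = c.countP (· < x) then {x} else 0) +
      fixedLettersAux c (x ::ₘ u) v

/-- The multiset of the fixed letters of a word, that is, of the letters at the positions which
are fixed by the standardization of the word. -/
def fixedLetters (w : List ℕ) : Multiset ℕ := fixedLettersAux w 0 w

theorem fixedLettersAux_append (c u : Multiset ℕ) (v v' : List ℕ) :
    fixedLettersAux c u (v ++ v') =
      fixedLettersAux c u v + fixedLettersAux c ((v : Multiset ℕ) + u) v' := by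
  induction v generalizing u with
  | nil => simp [fixedLettersAux]
  | cons x v ih =>
    rw [List.cons_append, fixedLettersAux, ih, fixedLettersAux, add_assoc, ← Multiset.cons_coe,
      Multiset.cons_add, Multiset.add_cons]

theorem fixedLettersAux_congr {c c' u u' : Multiset ℕ} {v : List ℕ}
    (h : ∀ (v₁ : List ℕ) (x : ℕ) (v₂ : List ℕ), v = v₁ ++ x :: v₂ →
      (((v₁ : Multiset ℕ) + u).countP (· ≠ x) = c.countP (· < x) ↔
        ((v₁ : Multiset ℕ) + u').countP (· ≠ x) = c'.countP (· < x))) :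
    fixedLettersAux c u v = fixedLettersAux c' u' v := by
  induction v generalizing u u' with
  | nil => rfl
  | cons x v ih =>
    have h0 := h [] x v rfl
    simp only [Multiset.coe_nil, zero_add] at h0
    rw [fixedLettersAux, fixedLettersAux, if_congr h0 rfl rfl, ih]
    intro v₁ y v₂ hv
    have := h (x :: v₁) y v₂ (by rw [hv, List.cons_append])
    simpa only [← Multiset.cons_coe, Multiset.cons_add, Multiset.add_cons] using this

theorem exists_of_mem_fixedLettersAux {c u : Multiset ℕ} {v : List ℕ} {a : ℕ}
    (h : a ∈ fixedLettersAux c u v) :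
    ∃ v₁ v₂, v = v₁ ++ a :: v₂ ∧
      ((v₁ : Multiset ℕ) + u).countP (· ≠ a) = c.countP (· < a) := by
  induction v generalizing u with
  | nil => simp [fixedLettersAux] at h
  | cons x v ih =>
    rw [fixedLettersAux, Multiset.mem_add] at h
    rcases h with h | h
    · split_ifs at h with hx
      · obtain rfl := Multiset.mem_singleton.1 h
        exact ⟨[], v, rfl, by simpa using hx⟩
      · simp at h
    · obtain ⟨v₁, v₂, rfl, h'⟩ := ih h
      exact ⟨x :: v₁, v₂, rfl, by
        simpa only [← Multiset.cons_coe, Multiset.cons_add, Multiset.add_cons] using h'⟩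

theorem fixedLettersAux_le (c u : Multiset ℕ) (v : List ℕ) : fixedLettersAux c u v ≤ v := by
  induction v generalizing u with
  | nil => simp [fixedLettersAux]
  | cons x v ih =>
    rw [fixedLettersAux, ← Multiset.cons_coe, ← Multiset.singleton_add x (v : Multiset ℕ)]
    refine add_le_add ?_ (ih _)
    split_ifs <;> simp

theorem countP_ne_add_count (u : Multiset ℕ) (x : ℕ) :
    u.countP (· ≠ x) + u.count x = u.card := by
  rw [Multiset.card_eq_countP_add_countP (· ≠ x), Multiset.count]
  simp [eq_comm]

theorem countP_lt_add_count_le (c : Multiset ℕ) {a x : ℕ} (h : a < x) :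
    c.countP (· < a) + c.count a ≤ c.countP (· < x) := by
  induction c using Multiset.induction_on with
  | empty => simp
  | cons y c ih =>
    simp only [Multiset.countP_cons, Multiset.count_cons]
    split_ifs <;> omega

/-- The letter `a` can be inserted as a fixed letter after any factor `u` with as many letters
`≠ a` as there are letters `< a` in the word, and this leaves the other fixed letters unchanged. -/
theorem fixedLetters_insert {a : ℕ} {u v : List ℕ}
    (h : (u : Multiset ℕ).countP (· ≠ a) = ((u ++ v : List ℕ) : Multiset ℕ).countP (· < a)) :
    fixedLetters (u ++ a :: v) = a ::ₘ fixedLetters (u ++ v) := by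
  have hc : ((u ++ a :: v : List ℕ) : Multiset ℕ) = a ::ₘ ((u ++ v : List ℕ) : Multiset ℕ) :=
    Multiset.coe_eq_coe.2 List.perm_middle
  rw [fixedLetters, fixedLetters, fixedLettersAux_append, fixedLettersAux_append, hc,
    fixedLettersAux]
  generalize hcc : ((u ++ v : List ℕ) : Multiset ℕ) = c at h ⊢
  rw [add_zero, Multiset.countP_cons_of_neg (p := (· < a)) _ (lt_irrefl a), if_pos h]
  have h1 : fixedLettersAux (a ::ₘ c) 0 u = fixedLettersAux c 0 u := by
    refine fixedLettersAux_congr fun u₁ x u₂ hu => ?_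
    have hle : (u₁ : Multiset ℕ) ≤ c := by
      rw [← hcc, hu, List.append_assoc]
      exact (List.sublist_append_left _ _).subperm
    have e1 := countP_ne_add_count (u₁ : Multiset ℕ) x
    have e2 := countP_ne_add_count (u₁ : Multiset ℕ) a
    have e3 := Multiset.count_le_of_le a hle
    rw [hu] at h
    rw [← Multiset.coe_add, ← Multiset.cons_coe, Multiset.countP_add, Multiset.countP_cons] at h
    rw [Multiset.countP_cons, add_zero]
    rcases lt_trichotomy a x with hax | rfl | hax
    · have e4 := countP_lt_add_count_le c hax
      rw [if_pos hax.ne'] at h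
      simp only [hax, if_true]
      omega
    · simp
    · simp [hax.not_gt]
  have h2 : fixedLettersAux (a ::ₘ c) (a ::ₘ (u : Multiset ℕ)) v =
      fixedLettersAux c (u : Multiset ℕ) v := by
    refine fixedLettersAux_congr fun v₁ x v₂ hv => ?_
    have hle : x ::ₘ ((v₁ : Multiset ℕ) + u) ≤ c := by
      rw [← hcc, hv, ← Multiset.coe_add, ← Multiset.coe_add, ← Multiset.cons_coe,
        Multiset.add_cons, Multiset.add_cons, add_comm (v₁ : Multiset ℕ), ← add_assoc]
      exact Multiset.cons_le_cons _ (Multiset.le_add_right _ _)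
    have e1 := countP_ne_add_count ((v₁ : Multiset ℕ) + u) x
    have e2 := countP_ne_add_count ((v₁ : Multiset ℕ) + u) a
    have e3 := Multiset.count_le_of_le x hle
    rw [Multiset.count_cons_self] at e3
    have e5 : (u : Multiset ℕ).countP (· ≠ a) ≤ ((v₁ : Multiset ℕ) + u).countP (· ≠ a) :=
      Multiset.countP_le_of_le _ (Multiset.le_add_left _ _)
    rw [Multiset.countP_cons, Multiset.add_cons, Multiset.countP_cons]
    rcases lt_trichotomy a x with hax | rfl | hax
    · simp [hax, hax.ne]
    · simp
    · have e4 := countP_lt_add_count_le c hax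
      simp only [hax.ne', hax.not_gt, ne_eq, not_false_eq_true, if_true, if_false]
      simp only [ne_eq] at e1 e2 e5 h
      omega
  rw [h1, h2, Multiset.singleton_add, Multiset.add_cons]

theorem cons_append_eq_append_cons {a : ℕ} {t v : List ℕ} (h : ∀ x ∈ t, x = a) :
    a :: (t ++ v) = t ++ a :: v := by
  induction t with
  | nil => rfl
  | cons b t ih =>
    obtain rfl := h b (by simp)
    rw [List.cons_append, List.cons_append, ← ih fun x hx => h x (by simp [hx])]

theorem forall_eq_of_countP_append {a : ℕ} {u t : List ℕ}
    (h : (u : Multiset ℕ).countP (· ≠ a) = ((u ++ t : List ℕ) : Multiset ℕ).countP (· ≠ a)) :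
    ∀ x ∈ t, x = a := by
  rw [← Multiset.coe_add, Multiset.countP_add] at h
  have h0 : (t : Multiset ℕ).countP (· ≠ a) = 0 := by omega
  simpa using Multiset.countP_eq_zero.1 h0

theorem insert_unique {a : ℕ} {u v u' v' : List ℕ} (h : u ++ v = u' ++ v')
    (hc : (u : Multiset ℕ).countP (· ≠ a) = (u' : Multiset ℕ).countP (· ≠ a)) :
    u ++ a :: v = u' ++ a :: v' := by
  rcases List.append_eq_append_iff.1 h with ⟨t, rfl, rfl⟩ | ⟨t, rfl, rfl⟩
  · rw [cons_append_eq_append_cons (forall_eq_of_countP_append hc), List.append_assoc]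
  · rw [cons_append_eq_append_cons (forall_eq_of_countP_append hc.symm), List.append_assoc]

theorem erase_unique_aux {a : ℕ} {v t v' : List ℕ} (h : a :: v = t ++ a :: v')
    (ht : ∀ x ∈ t, x = a) : v = t ++ v' := by
  rw [← cons_append_eq_append_cons ht] at h
  exact (List.cons.inj h).2

theorem erase_unique {a : ℕ} {u v u' v' : List ℕ} (h : u ++ a :: v = u' ++ a :: v')
    (hc : (u : Multiset ℕ).countP (· ≠ a) = (u' : Multiset ℕ).countP (· ≠ a)) :
    u ++ v = u' ++ v' := by
  rcases List.append_eq_append_iff.1 h with ⟨t, rfl, h'⟩ | ⟨t, rfl, h'⟩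
  · rw [erase_unique_aux h' (forall_eq_of_countP_append hc), List.append_assoc]
  · rw [erase_unique_aux h' (forall_eq_of_countP_append hc.symm), List.append_assoc]

theorem exists_prefix_countP {a m : ℕ} {w : List ℕ}
    (h : m ≤ (w : Multiset ℕ).countP (· ≠ a)) :
    ∃ u v, w = u ++ v ∧ (u : Multiset ℕ).countP (· ≠ a) = m := by
  induction w generalizing m with
  | nil => exact ⟨[], [], rfl, by simp at h; simp [h]⟩
  | cons x w ih =>
    rcases Nat.eq_zero_or_pos m with rfl | hm
    · exact ⟨[], x :: w, rfl, by simp⟩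
    · rw [← Multiset.cons_coe, Multiset.countP_cons] at h
      obtain ⟨u, v, rfl, hu⟩ := ih (m := m - if x ≠ a then 1 else 0) (by omega)
      refine ⟨x :: u, v, rfl, ?_⟩
      rw [← Multiset.cons_coe, Multiset.countP_cons, hu]
      split_ifs at h ⊢ <;> omega

/-- Inserting `a` as a fixed letter is a bijection onto the words with a fixed letter `a`: moving the
place of insertion across letters `a` does not change the resulting word. -/
theorem card_fixedLetters_cons (a : ℕ) (c M : Multiset ℕ) :
    #{w ∈ arrangements (a ::ₘ c) | fixedLetters w = a ::ₘ M} =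
      #{w ∈ arrangements c | fixedLetters w = M} := by
  have hcons : ∀ u v : List ℕ, ((u ++ a :: v : List ℕ) : Multiset ℕ) =
      a ::ₘ ((u ++ v : List ℕ) : Multiset ℕ) :=
    fun u v => Multiset.coe_eq_coe.2 List.perm_middle
  apply le_antisymm
  · refine Finset.card_le_card_of_forall_subsingleton
      (fun w' w => ∃ u v, w' = u ++ a :: v ∧ w = u ++ v ∧
        (u : Multiset ℕ).countP (· ≠ a) = c.countP (· < a)) ?_ ?_
    · intro w' hw'
      rw [Finset.mem_filter, mem_arrangements] at hw'
      obtain ⟨u, v, rfl, h⟩ := exists_of_mem_fixedLettersAux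
        (show a ∈ fixedLettersAux w' 0 w' by
          rw [← fixedLetters, hw'.2]; exact Multiset.mem_cons_self _ _)
      rw [hcons, Multiset.cons_inj_right] at hw'
      rw [hcons, hw'.1, add_zero, Multiset.countP_cons_of_neg (p := (· < a)) _ (lt_irrefl a)] at h
      refine ⟨u ++ v, ?_, u, v, rfl, rfl, h⟩
      rw [fixedLetters_insert (by rw [hw'.1, h]), Multiset.cons_inj_right] at hw'
      simpa using hw'
    · rintro w - w₁ ⟨-, u₁, v₁, rfl, h₁, e₁⟩ w₂ ⟨-, u₂, v₂, rfl, h₂, e₂⟩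
      exact insert_unique (h₁.symm.trans h₂) (e₁.trans e₂.symm)
  · refine Finset.card_le_card_of_forall_subsingleton
      (fun w w' => ∃ u v, w' = u ++ a :: v ∧ w = u ++ v ∧
        (u : Multiset ℕ).countP (· ≠ a) = c.countP (· < a)) ?_ ?_
    · intro w hw
      rw [Finset.mem_filter, mem_arrangements] at hw
      have hle : c.countP (· < a) ≤ (w : Multiset ℕ).countP (· ≠ a) := by
        rw [hw.1, Multiset.countP_eq_card_filter, Multiset.countP_eq_card_filter]
        exact Multiset.card_le_card
          (Multiset.monotone_filter_right _ fun x hx => hx.ne)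
      obtain ⟨u, v, rfl, h⟩ := exists_prefix_countP hle
      refine ⟨u ++ a :: v, ?_, u, v, rfl, rfl, h⟩
      rw [Finset.mem_filter, mem_arrangements, hcons, fixedLetters_insert (by rw [hw.1, h]),
        hw.1, hw.2]
      exact ⟨rfl, rfl⟩
    · rintro w' - w₁ ⟨-, u₁, v₁, h₁, rfl, e₁⟩ w₂ ⟨-, u₂, v₂, h₂, rfl, e₂⟩
      exact erase_unique (h₁.symm.trans h₂) (e₁.trans e₂.symm)

/-! ### The pixed factorization of a word -/

/-- The length of the longest strictly decreasing left factor of a word. -/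
def descRun : List ℕ → ℕ
  | [] => 0
  | [_] => 1
  | x :: y :: t => if y < x then descRun (y :: t) + 1 else 1

/-- What is left of a word on removing its longest right factor with `descRun` even. -/
def pixedPrefix : List ℕ → List ℕ
  | [] => []
  | x :: t => if Even (descRun (x :: t)) then [] else x :: pixedPrefix t

/-- The longest right factor of a word with `descRun` even. -/
def pixedSuffix : List ℕ → List ℕ
  | [] => []
  | x :: t => if Even (descRun (x :: t)) then x :: t else pixedSuffix t

theorem pixedPrefix_append_pixedSuffix (w : List ℕ) : pixedPrefix w ++ pixedSuffix w = w := by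
  induction w with
  | nil => rfl
  | cons x t ih =>
    simp only [pixedPrefix, pixedSuffix]
    split_ifs <;> simp [ih]

theorem even_descRun_pixedSuffix (w : List ℕ) : Even (descRun (pixedSuffix w)) := by
  induction w with
  | nil => simp [pixedSuffix, descRun]
  | cons x t ih =>
    simp only [pixedSuffix]
    split_ifs with h
    · exact h
    · exact ih

theorem pairwise_pixedPrefix (w : List ℕ) : (pixedPrefix w).Pairwise (· ≤ ·) := by
  induction w with
  | nil => simp [pixedPrefix]
  | cons x t ih =>
    obtain - | ⟨y, t⟩ := t
    · simp [pixedPrefix, descRun]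
    · by_cases hx : Even (descRun (x :: y :: t))
      · simp [pixedPrefix, hx]
      · rw [pixedPrefix, if_neg hx]
        by_cases hy : Even (descRun (y :: t))
        · simp [pixedPrefix, hy]
        · rw [pixedPrefix, if_neg hy] at ih ⊢
          have hxy : x ≤ y := by
            by_contra h
            rw [descRun, if_pos (not_le.1 h), Nat.even_add_one, not_not] at hx
            exact hy hx
          refine List.Pairwise.cons (fun z hz => ?_) ih
          rcases List.mem_cons.1 hz with rfl | hz
          · exact hxy
          · exact hxy.trans (List.rel_of_pairwise_cons ih hz)

theorem not_even_descRun_cons {x : ℕ} {u d : List ℕ} (hu : (x :: u).Pairwise (· ≤ ·))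
    (hd : Even (descRun d)) : ¬ Even (descRun (x :: (u ++ d))) := by
  obtain - | ⟨y, u⟩ := u
  · obtain - | ⟨y, d⟩ := d
    · simp [descRun]
    · simp only [List.nil_append, descRun]
      split_ifs
      · rw [Nat.even_add_one, not_not]; exact hd
      · simp
  · have hxy : x ≤ y := List.rel_of_pairwise_cons hu (by simp)
    simp [descRun, hxy.not_gt]

theorem pixedPrefix_append {u d : List ℕ} (hu : u.Pairwise (· ≤ ·)) (hd : Even (descRun d)) :
    pixedPrefix (u ++ d) = u := by
  induction u with
  | nil => cases d <;> simp_all [pixedPrefix]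
  | cons x u ih =>
    rw [List.cons_append, pixedPrefix, if_neg (not_even_descRun_cons hu hd), ih hu.of_cons]

theorem pixedSuffix_append {u d : List ℕ} (hu : u.Pairwise (· ≤ ·)) (hd : Even (descRun d)) :
    pixedSuffix (u ++ d) = d := by
  induction u with
  | nil => cases d <;> simp_all [pixedSuffix]
  | cons x u ih =>
    rw [List.cons_append, pixedSuffix, if_neg (not_even_descRun_cons hu hd), ih hu.of_cons]

/-- The multiset of the letters of the left factor of the pixed factorization. -/
def pixedLetters (w : List ℕ) : Multiset ℕ := pixedPrefix w

theorem pixedLetters_le (w : List ℕ) : pixedLetters w ≤ w := by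
  conv_rhs => rw [← pixedPrefix_append_pixedSuffix w, ← Multiset.coe_add]
  exact Multiset.le_add_right _ _

theorem sort_pixedLetters (w : List ℕ) : (pixedLetters w).sort (· ≤ ·) = pixedPrefix w := by
  rw [pixedLetters]
  exact List.Perm.eq_of_pairwise' (Multiset.pairwise_sort _ _) (pairwise_pixedPrefix w)
    (Multiset.coe_eq_coe.1 (Multiset.sort_eq _ _))

theorem card_pixedLetters_cons (a : ℕ) (c M : Multiset ℕ) :
    #{w ∈ arrangements (a ::ₘ c) | pixedLetters w = a ::ₘ M} =
      #{w ∈ arrangements c | pixedLetters w = M} := by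
  have key : ∀ (N : Multiset ℕ) (w : List ℕ),
      pixedLetters (N.sort (· ≤ ·) ++ pixedSuffix w) = N ∧
        pixedSuffix (N.sort (· ≤ ·) ++ pixedSuffix w) = pixedSuffix w := fun N w => by
    have h1 := Multiset.pairwise_sort N (· ≤ ·)
    have h2 := even_descRun_pixedSuffix w
    rw [pixedLetters, pixedPrefix_append h1 h2, pixedSuffix_append h1 h2, Multiset.sort_eq]
    exact ⟨rfl, rfl⟩
  have hw : ∀ w : List ℕ, (w : Multiset ℕ) = pixedLetters w + pixedSuffix w := fun w => by
    rw [pixedLetters, Multiset.coe_add, pixedPrefix_append_pixedSuffix]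
  refine Finset.card_nbij' (fun w => M.sort (· ≤ ·) ++ pixedSuffix w)
    (fun w => (a ::ₘ M).sort (· ≤ ·) ++ pixedSuffix w) ?_ ?_ ?_ ?_ <;>
    intro w h <;> simp only [Finset.coe_filter, Set.mem_ofPred_eq, mem_arrangements] at h ⊢
  · refine ⟨?_, (key M w).1⟩
    rw [hw, h.2, Multiset.cons_add, Multiset.cons_inj_right] at h
    rw [hw, (key M w).1, (key M w).2, h.1]
  · refine ⟨?_, (key _ w).1⟩
    rw [hw, (key _ w).1, (key _ w).2, ← h.1, hw w, h.2, Multiset.cons_add]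
  · rw [(key _ _).2, ← h.2, sort_pixedLetters, pixedPrefix_append_pixedSuffix]
  · rw [(key _ _).2, ← h.2, sort_pixedLetters, pixedPrefix_append_pixedSuffix]

/-! ### Equidistribution of fixed letters and pixed letters -/

/-- If the words with a letter `a` in `φ w` are obtained bijectively by inserting a letter `a`, which
adds `a` to `φ w`, then the distribution of `φ` on the rearrangement classes is determined by the
sizes of these classes. -/
theorem card_eq_of_cons {φ π : List ℕ → Multiset ℕ} (hφ : ∀ w, φ w ≤ w) (hπ : ∀ w, π w ≤ w)
    (hφc : ∀ a c M, #{w ∈ arrangements (a ::ₘ c) | φ w = a ::ₘ M} =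
      #{w ∈ arrangements c | φ w = M})
    (hπc : ∀ a c M, #{w ∈ arrangements (a ::ₘ c) | π w = a ::ₘ M} =
      #{w ∈ arrangements c | π w = M}) (c M : Multiset ℕ) :
    #{w ∈ arrangements c | φ w = M} = #{w ∈ arrangements c | π w = M} := by
  induction c using Multiset.strongInductionOn generalizing M with
  | _ c ih =>
  have hpos : ∀ M, M ≠ 0 →
      #{w ∈ arrangements c | φ w = M} = #{w ∈ arrangements c | π w = M} := by
    intro M hM
    obtain ⟨a, ha⟩ := Multiset.exists_mem_of_ne_zero hM
    obtain ⟨M, rfl⟩ := Multiset.exists_cons_of_mem ha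
    by_cases hac : a ∈ c
    · obtain ⟨c, rfl⟩ := Multiset.exists_cons_of_mem hac
      rw [hφc, hπc, ih c (Multiset.lt_cons_self c a)]
    · have : ∀ ψ : List ℕ → Multiset ℕ, (∀ w, ψ w ≤ w) →
          #{w ∈ arrangements c | ψ w = a ::ₘ M} = 0 := fun ψ hψ => by
        rw [Finset.card_eq_zero, Finset.filter_eq_empty_iff]
        intro w hw h
        refine hac (mem_arrangements.1 hw ▸ Multiset.mem_of_le (hψ w) ?_)
        rw [h]
        exact Multiset.mem_cons_self a M
      rw [this φ hφ, this π hπ]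
  by_cases hM : M = 0
  · subst hM
    -- the value `0` is what remains of the whole class when all other values are removed
    have hsum : ∀ ψ : List ℕ → Multiset ℕ, (∀ w, ψ w ≤ w) →
        #(arrangements c) = #{w ∈ arrangements c | ψ w = 0} +
          ∑ N ∈ (Multiset.powerset c).toFinset.erase 0, #{w ∈ arrangements c | ψ w = N} :=
        fun ψ hψ => by
      rw [Finset.add_sum_erase _ (fun N => #{w ∈ arrangements c | ψ w = N}) (by simp)]
      refine Finset.card_eq_sum_card_fiberwise fun w hw => ?_
      rw [Finset.mem_coe, Multiset.mem_toFinset, Multiset.mem_powerset, ← mem_arrangements.1 hw]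
      exact hψ w
    have h1 := hsum φ hφ
    have h2 := hsum π hπ
    rw [Finset.sum_congr rfl fun N hN => hpos N (Finset.ne_of_mem_erase hN)] at h1
    omega
  · exact hpos M hM

theorem card_fixedLetters_eq_card_pixedLetters (c M : Multiset ℕ) :
    #{w ∈ arrangements c | fixedLetters w = M} =
      #{w ∈ arrangements c | pixedLetters w = M} :=
  card_eq_of_cons (fun w => fixedLettersAux_le _ _ w) pixedLetters_le card_fixedLetters_cons
    card_pixedLetters_cons c M

/-- On each rearrangement class, the numbers of fixed letters and of pixed letters are
equidistributed. -/
theorem card_card_fixedLetters_eq (c : Multiset ℕ) (k : ℕ) :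
    #{w ∈ arrangements c | (fixedLetters w).card = k} =
      #{w ∈ arrangements c | (pixedLetters w).card = k} := by
  have hsum : ∀ ψ : List ℕ → Multiset ℕ, (∀ w, ψ w ≤ w) →
      #{w ∈ arrangements c | (ψ w).card = k} =
        ∑ N ∈ (Multiset.powerset c).toFinset with N.card = k,
          #{w ∈ arrangements c | ψ w = N} := fun ψ hψ => by
    rw [Finset.card_eq_sum_card_fiberwise (f := ψ)
      (t := {N ∈ (Multiset.powerset c).toFinset | N.card = k})]
    · refine Finset.sum_congr rfl fun N hN => ?_
      rw [Finset.filter_filter]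
      congr 1
      refine Finset.filter_congr fun w _ => ⟨fun h => h.2, fun h => ⟨?_, h⟩⟩
      rw [h]; exact (Finset.mem_filter.1 hN).2
    · intro w hw
      simp only [Finset.coe_filter, Set.mem_ofPred_eq, mem_arrangements] at hw
      have := hψ w
      rw [hw.1] at this
      simpa only [Finset.coe_filter, Set.mem_ofPred_eq, Multiset.mem_toFinset,
        Multiset.mem_powerset, hw.2, and_true] using this
  rw [hsum fixedLetters fun w => fixedLettersAux_le _ _ w, hsum _ pixedLetters_le]
  exact Finset.sum_congr rfl fun N _ => card_fixedLetters_eq_card_pixedLetters c N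

/-! ### Descents of words and the pixed decomposition of permutations -/

theorem one_le_descRun (x : ℕ) (t : List ℕ) : 1 ≤ descRun (x :: t) := by
  cases t with
  | nil => simp [descRun]
  | cons y t =>
    rw [descRun]
    split_ifs <;> omega

theorem descRun_eq_iff {x : ℕ} {t : List ℕ} {k : ℕ} :
    descRun (x :: t) = k ↔ (k ≤ (x :: t).length ∧ 1 ≤ k) ∧
      ((x :: t).take k).Pairwise (· > ·) ∧
        (k < (x :: t).length → (x :: t).getD (k - 1) 0 ≤ (x :: t).getD k 0) := by
  induction t generalizing x k with
  | nil =>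
    simp only [descRun, List.length_singleton]
    refine ⟨?_, fun h => by omega⟩
    rintro rfl
    simp
  | cons y t ih =>
    have hpos := one_le_descRun y t
    rcases k with - | - | k
    · have := one_le_descRun x (y :: t)
      simp only [nonpos_iff_eq_zero, one_ne_zero, and_false, false_and, iff_false]
      omega
    · by_cases h : y < x
      · simp [descRun, h]; omega
      · simp [descRun, h]; omega
    · have ih' := ih (x := y) (k := k + 1)
      by_cases h : y < x
      · have htake : (x :: y :: t).take (k + 1 + 1) = x :: (y :: t).take (k + 1) := rfl
        rw [descRun, if_pos h, Nat.add_right_cancel_iff, ih', htake, List.pairwise_cons]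
        have hall : ((y :: t).take (k + 1)).Pairwise (· > ·) →
            ∀ z ∈ (y :: t).take (k + 1), x > z := by
          intro hp z hz
          rw [List.take_succ_cons] at hp hz
          rcases List.mem_cons.1 hz with rfl | hz
          · exact h
          · exact lt_trans (List.rel_of_pairwise_cons hp hz) h
        simp only [List.length_cons, Nat.add_sub_cancel, List.getD_cons_succ]
        constructor
        · rintro ⟨h1, h2, h3⟩
          exact ⟨by omega, ⟨hall h2, h2⟩, fun h4 => h3 (by omega)⟩
        · rintro ⟨h1, h2, h3⟩
          exact ⟨by omega, h2.2, fun h4 => h3 (by omega)⟩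
      · rw [descRun, if_neg h]
        refine ⟨fun h' => by omega, ?_⟩
        rintro ⟨-, h2, -⟩
        rw [List.take_succ_cons, List.take_succ_cons] at h2
        exact absurd (List.rel_of_pairwise_cons h2 (by simp)) h

/-- With the convention that the empty word has `descRun` zero, the desarrangements among the words
without repetitions are the nonempty words with `descRun` even. -/
theorem isDesarrangement_cons_iff {x : ℕ} {t : List ℕ} (h : (x :: t).Nodup) :
    IsDesarrangement (x :: t) ↔ Even (descRun (x :: t)) := by
  have hlt : ∀ k, 1 ≤ k → k < (x :: t).length →
      ((x :: t).getD (k - 1) 0 ≤ (x :: t).getD k 0 ↔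
        (x :: t).getD (k - 1) 0 < (x :: t).getD k 0) := by
    intro k hk hk'
    refine ⟨fun h' => lt_of_le_of_ne h' fun e => ?_, le_of_lt⟩
    rw [List.getD_eq_getElem _ _ (by omega : k - 1 < _), List.getD_eq_getElem _ _ hk'] at e
    have := (h.getElem_inj_iff).1 e
    omega
  constructor
  · rintro ⟨k, hk, hk1, hp, hl⟩
    rw [descRun_eq_iff.2 ⟨⟨by omega, by omega⟩, hp,
      fun h' => (hlt _ (by omega) h').2 (hl h')⟩]
    exact even_two_mul k
  · rintro ⟨k, hk⟩
    obtain ⟨⟨h1, h2⟩, h3, h4⟩ := descRun_eq_iff.1 hk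
    rw [← two_mul] at h1 h2 h3 h4
    exact ⟨k, by omega, by omega, h3, fun h' => (hlt _ (by omega) h').1 (h4 h')⟩

theorem longestDesarrangement_eq {w : List ℕ} (h : w.Nodup) :
    longestDesarrangement w = pixedSuffix w := by
  induction w with
  | nil => rfl
  | cons x t ih =>
    rw [longestDesarrangement, pixedSuffix, ih h.of_cons]
    simp only [isDesarrangement_cons_iff h]

theorem cons_mem_wordDES_succ {x : ℕ} {t : List ℕ} {i : ℕ} :
    i + 2 ∈ wordDES (x :: t) ↔ i + 1 ∈ wordDES t := by
  simp only [mem_wordDES, List.length_cons]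
  simp
  omega

theorem one_mem_wordDES {x y : ℕ} {t : List ℕ} : 1 ∈ wordDES (x :: y :: t) ↔ y < x := by
  simp [mem_wordDES]

theorem wordDES_tail_congr {x x' : ℕ} {t t' : List ℕ}
    (h : wordDES (x :: t) = wordDES (x' :: t')) : wordDES t = wordDES t' := by
  ext i
  rcases i with - | i
  · simp [mem_wordDES]
  · rw [← cons_mem_wordDES_succ (x := x), h, cons_mem_wordDES_succ]

theorem descRun_congr {w w' : List ℕ} (hl : w.length = w'.length)
    (h : wordDES w = wordDES w') : descRun w = descRun w' := by
  induction w generalizing w' with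
  | nil =>
    rw [List.length_eq_zero_iff.1 hl.symm]
  | cons x t ih =>
    obtain - | ⟨x', t'⟩ := w'
    · simp at hl
    · obtain - | ⟨y, t⟩ := t <;> obtain - | ⟨y', t'⟩ := t'
      · rfl
      · simp at hl
      · simp at hl
      · have h1 := @one_mem_wordDES x y t
        rw [h, one_mem_wordDES] at h1
        rw [descRun, descRun, ih (by simpa using hl) (wordDES_tail_congr h), if_congr h1 rfl rfl]

/-- The place of the cut in the pixed factorization depends on the descent set only. -/
theorem length_pixedPrefix_congr {w w' : List ℕ} (hl : w.length = w'.length)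
    (h : wordDES w = wordDES w') : (pixedPrefix w).length = (pixedPrefix w').length := by
  induction w generalizing w' with
  | nil =>
    rw [List.length_eq_zero_iff.1 hl.symm]
  | cons x t ih =>
    obtain - | ⟨x', t'⟩ := w'
    · simp at hl
    · rw [pixedPrefix, pixedPrefix, descRun_congr hl h]
      split_ifs
      · rfl
      · rw [List.length_cons, List.length_cons,
          ih (by simpa using hl) (wordDES_tail_congr h)]

variable {n : ℕ}

@[simp]
theorem length_word (σ : Equiv.Perm (Fin n)) : (word σ).length = n := by simp [word]

theorem nodup_word (σ : Equiv.Perm (Fin n)) : (word σ).Nodup := by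
  rw [word, List.nodup_ofFn]
  intro i j h
  exact σ.injective (Fin.ext (by simpa using h))

theorem pixedRight_eq (σ : Equiv.Perm (Fin n)) : pixedRight σ = pixedSuffix (word σ) :=
  longestDesarrangement_eq (nodup_word σ)

theorem pixedLeft_eq (σ : Equiv.Perm (Fin n)) : pixedLeft σ = pixedPrefix (word σ) := by
  have h := pixedPrefix_append_pixedSuffix (word σ)
  have hl := congrArg List.length h
  rw [List.length_append, length_word] at hl
  rw [pixedLeft, pixedRight_eq]
  conv_lhs => rw [← h]
  exact List.take_left' (by rw [h]; omega)

theorem pixedLeft_append_pixedRight (σ : Equiv.Perm (Fin n)) :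
    pixedLeft σ ++ pixedRight σ = word σ := by
  rw [pixedLeft_eq, pixedRight_eq, pixedPrefix_append_pixedSuffix]

theorem nodup_pixedLeft (σ : Equiv.Perm (Fin n)) : (pixedLeft σ).Nodup :=
  (nodup_word σ).sublist (List.take_sublist _ _)

theorem pix_eq (σ : Equiv.Perm (Fin n)) : pix σ = (pixedPrefix (word σ)).length := by
  rw [pix, PIX, List.toFinset_card_of_nodup (nodup_pixedLeft σ), pixedLeft_eq]

theorem pix_congr {σ τ : Equiv.Perm (Fin n)} (h : DES σ = DES τ) : pix σ = pix τ := by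
  rw [pix_eq, pix_eq]
  exact length_pixedPrefix_congr (by simp) h

/-! ### Permutations with a prescribed set of possible descents as words -/

theorem mem_wordDES_ofFn {f : Fin n → ℕ} {i : ℕ} :
    i ∈ wordDES (List.ofFn f) ↔
      ∃ (_ : 1 ≤ i) (h : i < n), f ⟨i, h⟩ < f ⟨i - 1, by omega⟩ := by
  rw [mem_wordDES, List.length_ofFn]
  constructor
  · rintro ⟨⟨h1, h⟩, h2⟩
    rw [List.getD_eq_getElem _ _ (by simpa using h),
      List.getD_eq_getElem _ _ (by simp; omega), List.getElem_ofFn, List.getElem_ofFn] at h2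
    exact ⟨h1, h, h2⟩
  · rintro ⟨h1, h, h2⟩
    refine ⟨⟨h1, h⟩, ?_⟩
    rw [List.getD_eq_getElem _ _ (by simpa using h),
      List.getD_eq_getElem _ _ (by simp; omega), List.getElem_ofFn, List.getElem_ofFn]
    exact h2

theorem mem_DES {σ : Equiv.Perm (Fin n)} {i : ℕ} :
    i ∈ DES σ ↔ ∃ (_ : 1 ≤ i) (h : i < n), σ ⟨i, h⟩ < σ ⟨i - 1, by omega⟩ := by
  simp [DES, word, mem_wordDES_ofFn]

/-- The positions `0, 1, …` are cut into blocks before each element of `J`; this is the number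
of the block of the position `i`. -/
def blockIndex (J : Finset ℕ) (i : ℕ) : ℕ := #{j ∈ J | j ≤ i}

theorem blockIndex_mono (J : Finset ℕ) : Monotone (blockIndex J) := fun _ _ h =>
  Finset.card_le_card (Finset.monotone_filter_right _ fun _ _ h' => h'.trans h)

theorem blockIndex_succ (J : Finset ℕ) (i : ℕ) :
    blockIndex J (i + 1) = blockIndex J i + if i + 1 ∈ J then 1 else 0 := by
  have : {j ∈ J | j ≤ i + 1} = {j ∈ J | j ≤ i} ∪ if i + 1 ∈ J then {i + 1} else ∅ := by
    ext j
    split_ifs with h <;> simp only [Finset.mem_filter, Finset.mem_union, Finset.mem_singleton,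
      Finset.notMem_empty, or_false]
    · constructor
      · rintro ⟨h1, h2⟩
        rcases Nat.lt_or_ge i j with h3 | h3
        · exact Or.inr (by omega)
        · exact Or.inl ⟨h1, h3⟩
      · rintro (⟨h1, h2⟩ | rfl)
        · exact ⟨h1, by omega⟩
        · exact ⟨h, le_rfl⟩
    · constructor
      · rintro ⟨h1, h2⟩
        refine ⟨h1, ?_⟩
        by_contra h3
        exact h ((by omega : j = i + 1) ▸ h1)
      · rintro ⟨h1, h2⟩
        exact ⟨h1, by omega⟩
  rw [blockIndex, this, Finset.card_union_of_disjoint, blockIndex]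
  · split_ifs <;> simp
  · split_ifs <;> simp

/-- The descents of `σ` lie in `J` if and only if `σ` is increasing on each block of `J`. -/
theorem DES_subset_iff {σ : Equiv.Perm (Fin n)} {J : Finset ℕ} :
    DES σ ⊆ J ↔ ∀ i j : Fin n, i < j → blockIndex J i = blockIndex J j → σ i < σ j := by
  constructor
  · intro h
    have key : ∀ i d : ℕ, ∀ hd : i + 1 + d < n, blockIndex J i = blockIndex J (i + 1 + d) →
        σ ⟨i, by omega⟩ < σ ⟨i + 1 + d, hd⟩ := by
      have step : ∀ i : ℕ, ∀ hd : i + 1 < n, blockIndex J i = blockIndex J (i + 1) →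
          σ ⟨i, by omega⟩ < σ ⟨i + 1, hd⟩ := by
        intro i hd hb
        have hJ : i + 1 ∉ J := fun hJ => by
          rw [blockIndex_succ, if_pos hJ] at hb; omega
        have hD : i + 1 ∉ DES σ := fun hD => hJ (h hD)
        rw [mem_DES] at hD
        push Not at hD
        refine lt_of_le_of_ne (hD (by omega) hd) fun e => ?_
        simpa using σ.injective e
      intro i d
      induction d with
      | zero => exact step i
      | succ d ih =>
        intro hd hb
        have h1 := blockIndex_mono J (show i ≤ i + 1 + d by omega)
        have h2 := blockIndex_mono J (show i + 1 + d ≤ i + 1 + (d + 1) by omega)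
        exact (ih (by omega) (by omega)).trans
          (step (i + 1 + d) hd (by rw [show i + 1 + d + 1 = i + 1 + (d + 1) by omega]; omega))
    intro i j hij hb
    have hij' : (i : ℕ) < j := hij
    obtain ⟨d, hd⟩ : ∃ d, (j : ℕ) = i + 1 + d := ⟨j - (i + 1), by omega⟩
    have := key i d (by omega) (by rw [← hd, hb])
    simpa only [← hd] using this
  · intro h i hi
    obtain ⟨h1, h2, h3⟩ := mem_DES.1 hi
    by_contra hJ
    have hs := blockIndex_succ J (i - 1)
    rw [Nat.sub_add_cancel h1, if_neg hJ] at hs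
    exact absurd (h ⟨i - 1, by omega⟩ ⟨i, h2⟩ (Fin.mk_lt_mk.2 (by omega)) (by simp [hs]))
      h3.not_gt

/-- The word whose `i`-th letter is the block of the position of `i` in `σ`. If `σ` increases on
the blocks then the standardization of this word is `σ⁻¹`. -/
def blockWord (J : Finset ℕ) (σ : Equiv.Perm (Fin n)) : List ℕ :=
  List.ofFn fun i => blockIndex J (σ⁻¹ i : Fin n)

/-- The multiset of the letters of `blockWord J σ`. -/
def blockContent (n : ℕ) (J : Finset ℕ) : Multiset ℕ :=
  List.ofFn fun i : Fin n => blockIndex J i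

theorem eq_sort_of_DES_subset {σ : Equiv.Perm (Fin n)} {J : Finset ℕ} (h : DES σ ⊆ J) :
    σ = Tuple.sort fun i => blockIndex J (σ⁻¹ i : Fin n) := by
  rw [Tuple.eq_sort_iff]
  constructor
  · intro i j hij
    simpa using blockIndex_mono J hij
  · intro i j hij e
    exact DES_subset_iff.1 h i j hij (by simpa using e)

/-- Permutations with descents in `J` correspond to the words with letter multiset
`blockContent n J`; the inverse map is the stable sorting permutation. -/
theorem card_DES_subset (J : Finset ℕ) (P : Equiv.Perm (Fin n) → Prop) (Q : List ℕ → Prop)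
    [DecidablePred P] [DecidablePred Q]
    (h : ∀ σ, DES σ ⊆ J → (P σ ↔ Q (blockWord J σ))) :
    #{σ : Equiv.Perm (Fin n) | DES σ ⊆ J ∧ P σ} =
      #{w ∈ arrangements (blockContent n J) | Q w} := by
  refine Finset.card_bij (fun σ _ => blockWord J σ) ?_ ?_ ?_
  · intro σ hσ
    simp only [Finset.mem_filter, Finset.mem_univ, true_and] at hσ
    rw [Finset.mem_filter, mem_arrangements]
    exact ⟨Multiset.coe_eq_coe.2
      (Equiv.Perm.ofFn_comp_perm σ⁻¹ fun i : Fin n => blockIndex J i), (h σ hσ.1).1 hσ.2⟩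
  · intro σ hσ τ hτ e
    simp only [Finset.mem_filter, Finset.mem_univ, true_and] at hσ hτ
    rw [eq_sort_of_DES_subset hσ.1, eq_sort_of_DES_subset hτ.1]
    exact congrArg _ (List.ofFn_injective e)
  · intro w hw
    rw [Finset.mem_filter, mem_arrangements] at hw
    have hlen : w.length = n := by
      simpa [blockContent] using congrArg Multiset.card hw.1
    subst hlen
    set f : Fin w.length → ℕ := w.get with hf
    have hw' : List.ofFn f = w := List.ofFn_get w
    have hmono : Monotone (f ∘ Tuple.sort f) := Tuple.monotone_sort f
    have heq : f ∘ Tuple.sort f = fun i : Fin w.length => blockIndex J i := by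
      apply List.ofFn_injective
      refine List.Perm.eq_of_pairwise' (r := (· ≤ ·)) ?_ ?_ ?_
      · rw [List.pairwise_ofFn]
        exact fun i j hij => hmono hij.le
      · rw [List.pairwise_ofFn]
        exact fun i j hij => blockIndex_mono J hij.le
      · refine (Equiv.Perm.ofFn_comp_perm _ f).trans ?_
        rw [hw']
        exact Multiset.coe_eq_coe.1 hw.1
    have hword : blockWord J (Tuple.sort f) = w := by
      refine Eq.trans (congrArg List.ofFn (funext fun i => ?_)) hw'
      rw [← congrFun heq]
      simp
    have hDES : DES (Tuple.sort f) ⊆ J := by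
      rw [DES_subset_iff]
      intro i j hij e
      refine (Tuple.eq_sort_iff.1 rfl).2 i j hij ?_
      have h1 := congrFun heq i
      have h2 := congrFun heq j
      simp only [Function.comp] at h1 h2
      rw [h1, h2, e]
    refine ⟨Tuple.sort f, ?_, hword⟩
    simp only [Finset.mem_filter, Finset.mem_univ, true_and]
    exact ⟨hDES, (h _ hDES).2 (by rw [hword]; exact hw.2)⟩

section blockWord

variable {σ : Equiv.Perm (Fin n)} {J : Finset ℕ}

theorem inv_lt_inv_iff (h : DES σ ⊆ J) {i j : Fin n} :
    σ⁻¹ j < σ⁻¹ i ↔ blockIndex J (σ⁻¹ j : Fin n) < blockIndex J (σ⁻¹ i : Fin n) ∨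
      blockIndex J (σ⁻¹ j : Fin n) = blockIndex J (σ⁻¹ i : Fin n) ∧ j < i := by
  constructor
  · intro hlt
    rcases (blockIndex_mono J hlt.le).lt_or_eq with h' | h'
    · exact Or.inl h'
    · refine Or.inr ⟨h', ?_⟩
      simpa using DES_subset_iff.1 h _ _ hlt h'
  · rintro (h' | ⟨h', hij⟩)
    · by_contra hle
      exact absurd (blockIndex_mono J (not_lt.1 hle)) h'.not_ge
    · by_contra hle
      rcases (not_lt.1 hle).lt_or_eq with h'' | h''
      · have := DES_subset_iff.1 h _ _ h'' h'.symm
        exact absurd (by simpa using this) hij.not_gt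
      · exact hij.ne' (σ⁻¹.injective h'')

theorem wordDES_blockWord (h : DES σ ⊆ J) : wordDES (blockWord J σ) = IDES σ := by
  ext i
  rw [blockWord, mem_wordDES_ofFn, IDES, mem_DES]
  refine exists_congr fun h1 => exists_congr fun h2 => ?_
  rw [inv_lt_inv_iff h, or_iff_left]
  rintro ⟨-, h3⟩
  have := Fin.mk_lt_mk.1 h3
  omega

theorem wordMaj_blockWord (h : DES σ ⊆ J) : wordMaj (blockWord J σ) = imaj σ := by
  rw [wordMaj, wordDES_blockWord h, imaj]

theorem card_pixedLetters_blockWord (h : DES σ ⊆ J) :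
    (pixedLetters (blockWord J σ)).card = pix σ⁻¹ := by
  rw [pixedLetters, Multiset.coe_card, pix_eq]
  refine length_pixedPrefix_congr (by simp [blockWord]) ?_
  rw [wordDES_blockWord h, IDES, DES]

theorem wordInv_ofFn (f : Fin n → ℕ) :
    wordInv (List.ofFn f) = #{p : Fin n × Fin n | p.1 < p.2 ∧ f p.2 < f p.1} := by
  have hcount : ∀ {n : ℕ} (f : Fin n → ℕ) (a : ℕ),
      (List.ofFn f).countP (· < a) = ∑ j, if f j < a then 1 else 0 := by
    intro n f a
    induction n with
    | zero => simp
    | succ n ih => rw [List.ofFn_succ, List.countP_cons, ih, Fin.sum_univ_succ, add_comm]; simp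
  rw [Finset.card_filter, Fintype.sum_prod_type]
  induction n with
  | zero => simp [wordInv]
  | succ n ih =>
    rw [List.ofFn_succ, wordInv, ih, hcount]
    simp only [Fin.sum_univ_succ, Fin.succ_lt_succ_iff, Fin.succ_pos, Fin.not_lt_zero, true_and,
      false_and, if_false, zero_add]

theorem wordInv_word (σ : Equiv.Perm (Fin n)) : wordInv (word σ) = inv σ := by
  simp [word, wordInv_ofFn, inv]

theorem wordInv_blockWord (h : DES σ ⊆ J) : wordInv (blockWord J σ) = inv σ := by
  rw [blockWord, wordInv_ofFn, inv]
  refine Finset.card_nbij' (fun p => (σ⁻¹ p.2, σ⁻¹ p.1)) (fun p => (σ p.2, σ p.1)) ?_ ?_ ?_ ?_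
  · rintro ⟨i, j⟩ hp
    simp only [Finset.coe_filter, Finset.mem_univ, true_and, Set.mem_ofPred_eq] at hp
    simpa [hp.1] using (inv_lt_inv_iff h).2 (Or.inl hp.2)
  · rintro ⟨i, j⟩ hp
    simp only [Finset.coe_filter, Finset.mem_univ, true_and, Set.mem_ofPred_eq] at hp ⊢
    refine ⟨hp.2, ?_⟩
    have := (inv_lt_inv_iff h (i := σ j) (j := σ i)).1 (by simpa using hp.1)
    exact this.resolve_right fun h' => absurd h'.2 hp.2.not_gt
  · rintro ⟨i, j⟩ -
    simp
  · rintro ⟨i, j⟩ -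
    simp

theorem card_fixedLettersAux_ofFn (c u : Multiset ℕ) (f : Fin n → ℕ) :
    (fixedLettersAux c u (List.ofFn f)).card =
      #{i | u.countP (· ≠ f i) + #{j | j < i ∧ f j ≠ f i} = c.countP (· < f i)} := by
  induction n generalizing u with
  | zero => simp [fixedLettersAux]
  | succ n ih =>
    rw [List.ofFn_succ, fixedLettersAux, Multiset.card_add, ih, Fin.card_filter_univ_succ]
    have h0 : #{j : Fin (n + 1) | j < 0 ∧ f j ≠ f 0} = 0 := by simp
    have hs : ∀ i : Fin n, (f 0 ::ₘ u).countP (· ≠ f i.succ) +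
        #{j : Fin n | j < i ∧ f j.succ ≠ f i.succ} =
          u.countP (· ≠ f i.succ) + #{j | j < i.succ ∧ f j ≠ f i.succ} := by
      intro i
      rw [Fin.card_filter_univ_succ, Multiset.countP_cons]
      simp only [Fin.succ_pos, true_and, Fin.succ_lt_succ_iff]
      split_ifs <;> omega
    simp only [hs, h0, add_zero]
    split_ifs
    · simp; omega
    · simp

theorem card_fixedLetters_blockWord (h : DES σ ⊆ J) :
    (fixedLetters (blockWord J σ)).card = fix σ := by
  rw [fixedLetters, blockWord, card_fixedLettersAux_ofFn, fix, FIX,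
    Finset.card_image_of_injective _ fun i j hij => Fin.ext (by simpa using hij)]
  congr 1
  refine Finset.filter_congr fun i _ => ?_
  set w : Fin n → ℕ := fun i => blockIndex J (σ⁻¹ i : Fin n) with hw
  rw [← Fin.univ_val_map w, Multiset.countP_map, Multiset.countP_zero, zero_add]
  change #{j | j < i ∧ w j ≠ w i} = #{j | w j < w i} ↔ _
  -- both `i` and `σ⁻¹ i` are counted by splitting off the `j < i` with the same letter
  have h1 : (i : ℕ) = #{j | j < i ∧ w j ≠ w i} + #{j | j < i ∧ w j = w i} := by
    rw [← Finset.filter_filter, ← Finset.filter_filter, add_comm,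
      Finset.card_filter_add_card_filter_not, ← Fin.card_Iio]
    congr 1
    ext; simp
  have h2 : ((σ⁻¹ i : Fin n) : ℕ) = #{j | w j < w i} + #{j | j < i ∧ w j = w i} := by
    rw [← Finset.card_union_of_disjoint, ← Fin.card_Iio,
      ← Finset.card_map σ.toEmbedding]
    · congr 1
      ext j
      simp only [Finset.mem_map_equiv, Finset.mem_Iio, Finset.mem_union, Finset.mem_filter,
        Finset.mem_univ, true_and]
      refine (inv_lt_inv_iff h).trans ?_
      rw [and_comm (a := j < i)]
    · rw [Finset.disjoint_filter]
      intro j _ h3 h4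
      exact h3.ne h4.2
  have h3 : σ i = i ↔ ((σ⁻¹ i : Fin n) : ℕ) = i := by
    rw [← Fin.ext_iff, Equiv.Perm.inv_eq_iff_eq, eq_comm]
  rw [h3]
  omega

end blockWord

/-! ### The two equidistribution theorems on the symmetric group -/

/-- Inclusion-exclusion: the sizes of the fibres of a set-valued map are determined by the numbers
of the elements with value contained in a given set. -/
theorem card_filter_eq_of_card_filter_subset {α β : Type} {s : Finset α} {t : Finset β}
    {D : α → Finset ℕ} {D' : β → Finset ℕ}
    (h : ∀ J, #{x ∈ s | D x ⊆ J} = #{y ∈ t | D' y ⊆ J}) (E : Finset ℕ) :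
    #{x ∈ s | D x = E} = #{y ∈ t | D' y = E} := by
  have hsum : ∀ {γ : Type} (r : Finset γ) (G : γ → Finset ℕ) (J : Finset ℕ),
      #{x ∈ r | G x ⊆ J} = #{x ∈ r | G x = J} + ∑ F ∈ J.ssubsets, #{x ∈ r | G x = F} := by
    intro γ r G J
    have : #{x ∈ r | G x ⊆ J} = ∑ F ∈ J.powerset, #{x ∈ r | G x = F} := by
      rw [Finset.card_eq_sum_card_fiberwise (f := G) (t := J.powerset)]
      · refine Finset.sum_congr rfl fun F hF => ?_
        rw [Finset.filter_filter]
        congr 1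
        refine Finset.filter_congr fun x _ => ⟨fun h => h.2, fun h => ⟨?_, h⟩⟩
        rw [h]; exact Finset.mem_powerset.1 hF
      · intro x hx
        simpa using (Finset.mem_filter.1 hx).2
    rw [this, Finset.ssubsets,
      Finset.add_sum_erase _ (fun F => #{x ∈ r | G x = F}) (Finset.mem_powerset_self J)]
  induction E using Finset.strongInduction with
  | _ E ih =>
    have h1 := hsum s D E
    have h2 := hsum t D' E
    rw [h E, Finset.sum_congr rfl fun F hF => ih F (Finset.mem_ssubsets.1 hF)] at h1
    omega

/-- The Désarménien-Wachs theorem: `(fix, DES)` and `(pix, IDES)` are equidistributed. -/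
theorem card_fix_DES_eq_card_pix_IDES (k : ℕ) (E : Finset ℕ) :
    #{σ : Equiv.Perm (Fin n) | fix σ = k ∧ DES σ = E} =
      #{σ : Equiv.Perm (Fin n) | pix σ = k ∧ IDES σ = E} := by
  rw [← Finset.filter_filter, ← Finset.filter_filter]
  refine card_filter_eq_of_card_filter_subset (fun J => ?_) E
  rw [Finset.filter_filter, Finset.filter_filter]
  simp only [and_comm (a := fix _ = k)]
  rw [card_DES_subset J _ (fun w => (fixedLetters w).card = k)
    fun σ hσ => by rw [card_fixedLetters_blockWord hσ], card_card_fixedLetters_eq,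
    ← card_DES_subset J (fun σ => pix σ⁻¹ = k) _
      fun σ hσ => by rw [card_pixedLetters_blockWord hσ]]
  refine Finset.card_nbij' (·⁻¹) (·⁻¹) ?_ ?_ (fun σ _ => inv_inv σ) (fun σ _ => inv_inv σ) <;>
    intro σ hσ <;>
    simp only [Finset.coe_filter, Finset.mem_univ, true_and, Set.mem_ofPred_eq] at hσ ⊢ <;>
    simpa [IDES, and_comm] using hσ

/-- The Foata-Schützenberger theorem: `(DES, inv)` and `(DES, imaj)` are equidistributed. -/
theorem card_inv_DES_eq_card_imaj_DES (k : ℕ) (E : Finset ℕ) :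
    #{σ : Equiv.Perm (Fin n) | inv σ = k ∧ DES σ = E} =
      #{σ : Equiv.Perm (Fin n) | imaj σ = k ∧ DES σ = E} := by
  rw [← Finset.filter_filter, ← Finset.filter_filter]
  refine card_filter_eq_of_card_filter_subset (fun J => ?_) E
  rw [Finset.filter_filter, Finset.filter_filter]
  simp only [and_comm (b := DES _ ⊆ J)]
  rw [card_DES_subset J _ (fun w => wordInv w = k)
    fun σ hσ => by rw [wordInv_blockWord hσ], ← card_wordMaj_eq_card_wordInv,
    ← card_DES_subset J (fun σ => imaj σ = k) _
      fun σ hσ => by rw [wordMaj_blockWord hσ]]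

/-! ### Fibres of the fixed and of the pixed decomposition -/

/-- The set of the letters `i + 1` with `i ∈ S`. -/
def letters (S : Finset (Fin n)) : Finset ℕ := S.image fun i : Fin n => (i : ℕ) + 1

theorem succ_val_injective : Function.Injective fun i : Fin n => (i : ℕ) + 1 :=
  fun i j h => Fin.ext (by simpa using h)

theorem mem_letters {S : Finset (Fin n)} {i : Fin n} : (i : ℕ) + 1 ∈ letters S ↔ i ∈ S :=
  succ_val_injective.mem_finset_image

theorem card_letters (S : Finset (Fin n)) : #(letters S) = #S :=
  Finset.card_image_of_injective _ succ_val_injective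

theorem exists_eq_letters {A : Finset ℕ} (hA : A ⊆ Finset.Icc 1 n) :
    ∃ S : Finset (Fin n), A = letters S := by
  refine ⟨Finset.univ.filter fun i : Fin n => (i : ℕ) + 1 ∈ A, ?_⟩
  ext a
  simp only [letters, Finset.mem_image, Finset.mem_filter, Finset.mem_univ, true_and]
  constructor
  · intro ha
    have := Finset.mem_Icc.1 (hA ha)
    have hs : a - 1 + 1 = a := by omega
    exact ⟨⟨a - 1, by omega⟩, by simpa only [hs] using ha, hs⟩
  · rintro ⟨i, hi, rfl⟩
    exact hi

theorem mem_Icc_sdiff_letters {S : Finset (Fin n)} {b : ℕ} :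
    b ∈ Finset.Icc 1 n \ letters S ↔ b ∈ letters Sᶜ := by
  simp only [Finset.mem_sdiff, Finset.mem_Icc]
  constructor
  · rintro ⟨⟨h1, h2⟩, h3⟩
    have hs : b - 1 + 1 = b := by omega
    have h4 := mem_letters (S := S) (i := ⟨b - 1, by omega⟩)
    have h5 := mem_letters (S := Sᶜ) (i := ⟨b - 1, by omega⟩)
    simp only [hs] at h4 h5
    rw [h5, Finset.mem_compl, ← h4]
    exact h3
  · intro h
    obtain ⟨i, hi, rfl⟩ := Finset.mem_image.1 h
    rw [mem_letters]
    exact ⟨by omega, Finset.mem_compl.1 hi⟩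

theorem FIX_eq_letters (σ : Equiv.Perm (Fin n)) : FIX σ = letters {i | σ i = i} := rfl

theorem FIX_eq_letters_iff {σ : Equiv.Perm (Fin n)} {S : Finset (Fin n)} :
    FIX σ = letters S ↔ ∀ i, σ i = i ↔ i ∈ S := by
  rw [FIX_eq_letters, letters, letters, (Finset.image_injective succ_val_injective).eq_iff,
    Finset.ext_iff]
  simp

theorem fix_eq_zero_iff {σ : Equiv.Perm (Fin n)} : fix σ = 0 ↔ ∀ i, σ i ≠ i := by
  rw [fix, FIX_eq_letters, card_letters, Finset.card_eq_zero, Finset.filter_eq_empty_iff]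
  simp

theorem word_injective : Function.Injective (word : Equiv.Perm (Fin n) → List ℕ) := by
  intro σ τ h
  ext i
  simpa using congrFun (List.ofFn_injective h) i

theorem PIX_subset (σ : Equiv.Perm (Fin n)) : PIX σ ⊆ Finset.Icc 1 n := by
  intro a ha
  have : a ∈ word σ := List.mem_of_mem_take (List.mem_toFinset.1 ha)
  obtain ⟨i, rfl⟩ := List.mem_ofFn.1 this
  rw [Finset.mem_Icc]
  omega

theorem FIX_subset (σ : Equiv.Perm (Fin n)) : FIX σ ⊆ Finset.Icc 1 n := by
  intro a ha
  obtain ⟨i, -, rfl⟩ := Finset.mem_image.1 ha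
  rw [Finset.mem_Icc]
  omega

/-- The set of the `i < n` such that either `i` is not in `A` and `i + 1` is, or `i` and `i + 1`
are the letters number `j` and `j + 1` of the complement of `A`, with `j ∈ E`. -/
def insertDES (n : ℕ) (A E : Finset ℕ) : Finset ℕ :=
  {i ∈ Finset.Ico 1 n | i ∉ A ∧ (i + 1 ∈ A ∨ red (Finset.Icc 1 n \ A) i ∈ E)}

section embedding

variable {m : ℕ} {S : Finset (Fin n)} (hm : #Sᶜ = m)

theorem orderEmbOfFin_compl_notMem (x : Fin m) : Sᶜ.orderEmbOfFin hm x ∉ S :=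
  Finset.mem_compl.1 (Finset.orderEmbOfFin_mem _ hm x)

theorem exists_orderEmbOfFin_eq {T : Finset (Fin n)} (hT : #T = m) {i : Fin n} (hi : i ∈ T) :
    ∃ x, T.orderEmbOfFin hT x = i := by
  have : i ∈ Set.range (T.orderEmbOfFin hT) := by
    rw [Finset.range_orderEmbOfFin]; exact hi
  exact this

theorem red_orderEmbOfFin {B : Finset ℕ} (hB : ∀ b, b ∈ B ↔ b ∈ letters Sᶜ) (x : Fin m) :
    red B ((Sᶜ.orderEmbOfFin hm x : ℕ) + 1) = x + 1 := by
  have : {b ∈ B | b ≤ (Sᶜ.orderEmbOfFin hm x : ℕ) + 1} =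
      (Finset.Iic x).image fun y => (Sᶜ.orderEmbOfFin hm y : ℕ) + 1 := by
    ext b
    simp only [Finset.mem_filter, hB, letters, Finset.mem_image, Finset.mem_Iic]
    constructor
    · rintro ⟨⟨i, hi, rfl⟩, hb⟩
      obtain ⟨y, rfl⟩ := exists_orderEmbOfFin_eq hm hi
      refine ⟨y, ?_, rfl⟩
      rw [← (Sᶜ.orderEmbOfFin hm).le_iff_le, Fin.le_def]
      omega
    · rintro ⟨y, hy, rfl⟩
      refine ⟨⟨_, Finset.orderEmbOfFin_mem _ hm y, rfl⟩, ?_⟩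
      have := Fin.le_def.1 ((Sᶜ.orderEmbOfFin hm).le_iff_le.2 hy)
      omega
  rw [red, this, Finset.card_image_of_injective, Fin.card_Iic]
  intro y z h
  exact (Sᶜ.orderEmbOfFin hm).injective (Fin.ext (by simpa using h))

/-- If `f` is weakly increasing on `S`, and smaller on `S` than off `S`, then the descents of its
word are determined by `S` and by the descents of the word `g` of the values of `f` off `S`, up to
order isomorphism. For `f` the letters of `ZDer σ`, `S` is the set of the fixed points; for `f`
the letters of `σ⁻¹`, it is `PIX σ`. -/
theorem wordDES_ofFn_eq_insertDES {f : Fin n → ℕ} {g : Fin m → ℕ}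
    (hSS : ∀ i ∈ S, ∀ j ∈ S, i < j → f i ≤ f j) (hST : ∀ i ∈ S, ∀ j ∉ S, f i < f j)
    (hTT : ∀ x y, f (Sᶜ.orderEmbOfFin hm x) < f (Sᶜ.orderEmbOfFin hm y) ↔ g x < g y) :
    wordDES (List.ofFn f) = insertDES n (letters S) (wordDES (List.ofFn g)) := by
  ext i
  by_cases hi : 1 ≤ i ∧ i < n
  swap
  · rw [insertDES, Finset.mem_filter, mem_wordDES_ofFn, Finset.mem_Ico]
    exact ⟨fun ⟨h1, h2, _⟩ => absurd ⟨h1, h2⟩ hi, fun h => absurd h.1 hi⟩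
  obtain ⟨h1, h2⟩ := hi
  obtain ⟨i, rfl⟩ : ∃ j, i = j + 1 := ⟨i - 1, by omega⟩
  have hp := mem_letters (S := S) (i := ⟨i, by omega⟩)
  have hq := mem_letters (S := S) (i := ⟨i + 1, h2⟩)
  simp only at hp hq
  rw [insertDES, Finset.mem_filter, mem_wordDES_ofFn, Finset.mem_Ico, hp, hq,
    exists_prop_of_true h1, exists_prop_of_true h2]
  simp only [Nat.add_sub_cancel]
  have hlt : (⟨i, by omega⟩ : Fin n) < ⟨i + 1, h2⟩ := Fin.mk_lt_mk.2 (by omega)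
  generalize hP : (⟨i, by omega⟩ : Fin n) = p at hlt ⊢
  generalize hQ : (⟨i + 1, h2⟩ : Fin n) = q at hlt ⊢
  have hpi : (p : ℕ) = i := by rw [← hP]
  have hqi : (q : ℕ) = i + 1 := by rw [← hQ]
  by_cases hpS : p ∈ S
  · simp only [hpS, not_true_eq_false, false_and, and_false, iff_false, not_lt]
    by_cases hqS : q ∈ S
    · exact hSS p hpS q hqS hlt
    · exact (hST p hpS q hqS).le
  · by_cases hqS : q ∈ S
    · simp only [hpS, hqS, not_false_eq_true, true_or, and_true, h1, h2, iff_true]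
      exact hST q hqS p hpS
    · obtain ⟨x, rfl⟩ := exists_orderEmbOfFin_eq hm (Finset.mem_compl.2 hpS)
      obtain ⟨y, rfl⟩ := exists_orderEmbOfFin_eq hm (Finset.mem_compl.2 hqS)
      have hxy : x < y := (Sᶜ.orderEmbOfFin hm).lt_iff_lt.1 hlt
      -- nothing lies between adjacent letters, so their ranks are adjacent
      have hyx : (y : ℕ) = x + 1 := by
        by_contra hne
        have hxy' := Fin.lt_def.1 hxy
        have ha := Fin.lt_def.1 ((Sᶜ.orderEmbOfFin hm).lt_iff_lt.2
          (show x < ⟨x + 1, by omega⟩ from Fin.lt_def.2 (Nat.lt_succ_self _)))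
        have hb := Fin.lt_def.1 ((Sᶜ.orderEmbOfFin hm).lt_iff_lt.2
          (show ⟨x + 1, by omega⟩ < y from Fin.lt_def.2 (by simp only; omega)))
        omega
      have hy1 : y = ⟨x + 1, by omega⟩ := Fin.ext hyx
      rw [hTT, ← hpi, red_orderEmbOfFin hm fun b => mem_Icc_sdiff_letters, mem_wordDES_ofFn,
        hy1]
      have hxm : (x : ℕ) + 1 < m := by omega
      simp [orderEmbOfFin_compl_notMem, hpi, h2, hxm, ← hy1]

/-- `S` is the set of fixed points of `σ`, and `τ` is the derangement to which the action of `σ` on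
the complement of `S` reduces. The increasing bijection onto the complement is
`Sᶜ.orderEmbOfFin hm`. -/
structure IsDerangementPart (σ : Equiv.Perm (Fin n)) (τ : Equiv.Perm (Fin m)) : Prop where
  apply_eq_self : ∀ i ∈ S, σ i = i
  apply_emb : ∀ x, σ (Sᶜ.orderEmbOfFin hm x) = Sᶜ.orderEmbOfFin hm (τ x)
  apply_ne : ∀ x, τ x ≠ x

variable {hm}

namespace IsDerangementPart

variable {σ : Equiv.Perm (Fin n)} {τ : Equiv.Perm (Fin m)}

theorem apply_eq_iff (h : IsDerangementPart hm σ τ) (i : Fin n) : σ i = i ↔ i ∈ S := by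
  refine ⟨fun hi => ?_, h.apply_eq_self i⟩
  by_contra hS
  obtain ⟨x, rfl⟩ := exists_orderEmbOfFin_eq hm (Finset.mem_compl.2 hS)
  rw [h.apply_emb] at hi
  exact h.apply_ne x ((Sᶜ.orderEmbOfFin hm).injective hi)

theorem FIX_eq (h : IsDerangementPart hm σ τ) : FIX σ = letters S :=
  FIX_eq_letters_iff.2 h.apply_eq_iff

theorem red_apply (h : IsDerangementPart hm σ τ) (x : Fin m) :
    red (nonFIX σ) ((σ (Sᶜ.orderEmbOfFin hm x) : ℕ) + 1) = τ x + 1 := by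
  rw [h.apply_emb, nonFIX, h.FIX_eq, red_orderEmbOfFin hm fun b => mem_Icc_sdiff_letters]

theorem Der_eq (h : IsDerangementPart hm σ τ) : Der σ = word τ := by
  have hlist : (List.finRange n).filter (fun i => σ i ≠ i) =
      List.ofFn fun x => Sᶜ.orderEmbOfFin hm x := by
    refine List.Perm.eq_of_pairwise' (r := (· ≤ ·)) ?_ ?_ ?_
    · exact ((List.pairwise_lt_finRange n).imp le_of_lt).filter _
    · rw [List.pairwise_ofFn]
      exact fun i j hij => ((Sᶜ.orderEmbOfFin hm).lt_iff_lt.2 hij).le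
    · rw [List.perm_ext_iff_of_nodup ((List.nodup_finRange n).filter _)
        (List.nodup_ofFn.2 (Sᶜ.orderEmbOfFin hm).injective)]
      intro i
      rw [List.mem_ofFn, ← Set.mem_range, Finset.range_orderEmbOfFin, Finset.mem_coe,
        Finset.mem_compl]
      simp [h.apply_eq_iff]
  rw [Der, hlist, List.map_ofFn, word]
  exact congrArg List.ofFn (funext h.red_apply)

theorem DEZ_eq (h : IsDerangementPart hm σ τ) :
    DEZ σ = insertDES n (letters S) (DES τ) := by
  refine wordDES_ofFn_eq_insertDES hm ?_ ?_ ?_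
  · intro i hi j hj _
    simp [(h.apply_eq_iff _).2, hi, hj]
  · intro i hi j hj
    obtain ⟨y, rfl⟩ := exists_orderEmbOfFin_eq hm (Finset.mem_compl.2 hj)
    rw [if_pos ((h.apply_eq_iff _).2 hi), if_neg (mt (h.apply_eq_iff _).1 hj), h.red_apply]
    omega
  · intro x y
    rw [if_neg (mt (h.apply_eq_iff _).1 (orderEmbOfFin_compl_notMem hm x)),
      if_neg (mt (h.apply_eq_iff _).1 (orderEmbOfFin_compl_notMem hm y)), h.red_apply,
      h.red_apply]

end IsDerangementPart

theorem exists_isDerangementPart {σ : Equiv.Perm (Fin n)} (hσ : FIX σ = letters S) :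
    ∃ τ, IsDerangementPart hm σ τ := by
  rw [FIX_eq_letters_iff] at hσ
  have hex : ∀ x, ∃ y, Sᶜ.orderEmbOfFin hm y = σ (Sᶜ.orderEmbOfFin hm x) := by
    intro x
    refine exists_orderEmbOfFin_eq hm (Finset.mem_compl.2 fun hS => ?_)
    have := σ.injective ((hσ _).2 hS)
    exact orderEmbOfFin_compl_notMem hm x ((hσ _).1 this)
  choose t ht using hex
  have hinj : Function.Injective t := fun x y h =>
    (Sᶜ.orderEmbOfFin hm).injective (σ.injective (by rw [← ht, ← ht, h]))
  refine ⟨Equiv.ofBijective t (Finite.injective_iff_bijective.1 hinj),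
    fun i hi => (hσ i).2 hi, fun x => (ht x).symm, fun x hx => ?_⟩
  have hx : t x = x := hx
  have := ht x
  rw [hx] at this
  exact orderEmbOfFin_compl_notMem hm x ((hσ _).1 this.symm)

theorem exists_isDerangementPart_of_derangement {τ : Equiv.Perm (Fin m)} (hτ : ∀ x, τ x ≠ x) :
    ∃ σ, IsDerangementPart hm σ τ := by
  refine ⟨τ.extendDomain (Sᶜ.orderIsoOfFin hm).toEquiv, fun i hi => ?_, fun x => ?_, hτ⟩
  · exact Equiv.Perm.extendDomain_apply_not_subtype _ _ (by simpa using hi)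
  · exact Equiv.Perm.extendDomain_apply_image τ (Sᶜ.orderIsoOfFin hm).toEquiv x

/-- The permutations with a given set of fixed points correspond to the derangements. -/
theorem card_FIX_eq (hm : #Sᶜ = m) (P : List ℕ → Prop) [DecidablePred P] :
    #{σ : Equiv.Perm (Fin n) | FIX σ = letters S ∧ P (Der σ)} =
      #{τ : Equiv.Perm (Fin m) | fix τ = 0 ∧ P (word τ)} := by
  apply le_antisymm
  · refine Finset.card_le_card_of_forall_subsingleton (IsDerangementPart hm) ?_ ?_
    · intro σ hσ
      rw [Finset.mem_filter_univ] at hσ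
      obtain ⟨τ, h⟩ := exists_isDerangementPart (hm := hm) hσ.1
      refine ⟨τ, ?_, h⟩
      rw [Finset.mem_filter_univ, fix_eq_zero_iff, ← h.Der_eq]
      exact ⟨h.apply_ne, hσ.2⟩
    · rintro τ - σ ⟨-, h⟩ σ' ⟨-, h'⟩
      refine Equiv.ext fun i => ?_
      by_cases hi : i ∈ S
      · rw [h.apply_eq_self i hi, h'.apply_eq_self i hi]
      · obtain ⟨x, rfl⟩ := exists_orderEmbOfFin_eq hm (Finset.mem_compl.2 hi)
        rw [h.apply_emb, h'.apply_emb]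
  · refine Finset.card_le_card_of_forall_subsingleton
      (fun τ σ => IsDerangementPart hm σ τ) ?_ ?_
    · intro τ hτ
      rw [Finset.mem_filter_univ, fix_eq_zero_iff] at hτ
      obtain ⟨σ, h⟩ := exists_isDerangementPart_of_derangement (hm := hm) hτ.1
      refine ⟨σ, ?_, h⟩
      rw [Finset.mem_filter_univ, h.Der_eq]
      exact ⟨h.FIX_eq, hτ.2⟩
    · rintro σ - τ ⟨-, h⟩ τ' ⟨-, h'⟩
      exact word_injective (h.Der_eq.symm.trans h'.Der_eq)

end embedding

theorem DEZ_eq_insertDES (σ : Equiv.Perm (Fin n)) :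
    DEZ σ = insertDES n (FIX σ) (wordDES (Der σ)) := by
  obtain ⟨τ, h⟩ := exists_isDerangementPart (hm := rfl) (FIX_eq_letters σ)
  rw [h.DEZ_eq, h.Der_eq, FIX_eq_letters, DES]

theorem pix_eq_zero_iff {σ : Equiv.Perm (Fin n)} : pix σ = 0 ↔ Even (descRun (word σ)) := by
  rw [pix_eq, List.length_eq_zero_iff]
  cases word σ with
  | nil => simp [pixedPrefix, descRun]
  | cons x t =>
    rw [pixedPrefix]
    split_ifs with h <;> simp [h]

section glue

variable {k m : ℕ} {S : Finset (Fin (k + m))} (hk : #S = k) (hm : #Sᶜ = m)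

/-- The permutation with word `u v`, where `u` is the increasing word of the letters of `S`, and
`v` is the word in the remaining letters that reduces to the word of `κ`. -/
def glue (κ : Equiv.Perm (Fin m)) : Equiv.Perm (Fin (k + m)) :=
  finSumFinEquiv.symm.trans
    ((Equiv.sumCongr (Equiv.refl _) κ).trans (finSumEquivOfFinset hk hm))

@[simp]
theorem glue_castAdd (κ : Equiv.Perm (Fin m)) (i : Fin k) :
    glue hk hm κ (Fin.castAdd m i) = S.orderEmbOfFin hk i := by
  simp [glue]

@[simp]
theorem glue_natAdd (κ : Equiv.Perm (Fin m)) (x : Fin m) :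
    glue hk hm κ (Fin.natAdd k x) = Sᶜ.orderEmbOfFin hm (κ x) := by
  simp [glue]

theorem word_glue (κ : Equiv.Perm (Fin m)) :
    word (glue hk hm κ) = (List.ofFn fun i => (S.orderEmbOfFin hk i : ℕ) + 1) ++
      List.ofFn fun x => (Sᶜ.orderEmbOfFin hm (κ x) : ℕ) + 1 := by
  rw [word, List.ofFn_add]
  simp only [← glue_natAdd hk hm κ, ← glue_castAdd hk hm κ]
  rfl

theorem descRun_ofFn_orderEmbOfFin (κ : Equiv.Perm (Fin m)) :
    descRun (List.ofFn fun x => (Sᶜ.orderEmbOfFin hm (κ x) : ℕ) + 1) = descRun (word κ) := by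
  refine descRun_congr (by simp) ?_
  ext i
  rw [mem_wordDES_ofFn, word, mem_wordDES_ofFn]
  simp

theorem pairwise_ofFn_orderEmbOfFin :
    (List.ofFn fun i => (S.orderEmbOfFin hk i : ℕ) + 1).Pairwise (· ≤ ·) := by
  rw [List.pairwise_ofFn]
  intro i j hij
  have := Fin.lt_def.1 ((S.orderEmbOfFin hk).lt_iff_lt.2 hij)
  omega

theorem toFinset_ofFn_orderEmbOfFin {n m : ℕ} {T : Finset (Fin n)} (hT : #T = m)
    (κ : Equiv.Perm (Fin m)) :
    (List.ofFn fun x => (T.orderEmbOfFin hT (κ x) : ℕ) + 1).toFinset = letters T := by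
  ext a
  rw [List.mem_toFinset, List.mem_ofFn, letters, Finset.mem_image]
  constructor
  · rintro ⟨x, rfl⟩
    exact ⟨_, Finset.orderEmbOfFin_mem _ hT _, rfl⟩
  · rintro ⟨i, hi, rfl⟩
    obtain ⟨x, rfl⟩ := exists_orderEmbOfFin_eq hT hi
    exact ⟨κ.symm x, by simp⟩

variable {κ : Equiv.Perm (Fin m)}

theorem PIX_glue (hκ : pix κ = 0) : PIX (glue hk hm κ) = letters S := by
  rw [pix_eq_zero_iff, ← descRun_ofFn_orderEmbOfFin hm] at hκ
  rw [PIX, pixedLeft_eq, word_glue, pixedPrefix_append (pairwise_ofFn_orderEmbOfFin hk) hκ]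
  exact toFinset_ofFn_orderEmbOfFin hk (Equiv.refl _)

theorem Desar_glue (hκ : pix κ = 0) : Desar (glue hk hm κ) = word κ := by
  rw [pix_eq_zero_iff, ← descRun_ofFn_orderEmbOfFin hm] at hκ
  rw [Desar, pixedRight_eq, word_glue, pixedSuffix_append (pairwise_ofFn_orderEmbOfFin hk) hκ,
    toFinset_ofFn_orderEmbOfFin hm, List.map_ofFn, word]
  exact congrArg List.ofFn (funext fun x => red_orderEmbOfFin hm (fun _ => Iff.rfl) (κ x))

theorem IDES_glue (κ : Equiv.Perm (Fin m)) :
    IDES (glue hk hm κ) = insertDES (k + m) (letters S) (IDES κ) := by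
  have hS : ∀ i, (glue hk hm κ)⁻¹ (S.orderEmbOfFin hk i) = Fin.castAdd m i := fun i => by
    rw [Equiv.Perm.inv_eq_iff_eq, glue_castAdd]
  have hT : ∀ x, (glue hk hm κ)⁻¹ (Sᶜ.orderEmbOfFin hm x) = Fin.natAdd k (κ⁻¹ x) := fun x => by
    rw [Equiv.Perm.inv_eq_iff_eq, glue_natAdd]
    simp
  refine wordDES_ofFn_eq_insertDES hm ?_ ?_ ?_
  · intro i hi j hj hij
    obtain ⟨i, rfl⟩ := exists_orderEmbOfFin_eq hk hi
    obtain ⟨j, rfl⟩ := exists_orderEmbOfFin_eq hk hj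
    have := Fin.lt_def.1 ((S.orderEmbOfFin hk).lt_iff_lt.1 hij)
    rw [hS, hS, Fin.val_castAdd, Fin.val_castAdd]
    omega
  · intro i hi j hj
    obtain ⟨i, rfl⟩ := exists_orderEmbOfFin_eq hk hi
    obtain ⟨j, rfl⟩ := exists_orderEmbOfFin_eq hm (Finset.mem_compl.2 hj)
    rw [hS, hT, Fin.val_castAdd, Fin.val_natAdd]
    omega
  · intro x y
    rw [hT, hT, Fin.val_natAdd, Fin.val_natAdd]
    omega

theorem exists_eq_glue {σ : Equiv.Perm (Fin (k + m))} (hσ : PIX σ = letters S) :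
    ∃ κ, pix κ = 0 ∧ σ = glue hk hm κ := by
  have hlen : (pixedPrefix (word σ)).length = k := by
    rw [← pix_eq, pix, hσ, card_letters, hk]
  have hsplit : pixedPrefix (word σ) ++ pixedSuffix (word σ) =
      (List.ofFn fun i => (σ (Fin.castAdd m i) : ℕ) + 1) ++
        List.ofFn fun x => (σ (Fin.natAdd k x) : ℕ) + 1 := by
    rw [pixedPrefix_append_pixedSuffix, word, List.ofFn_add]
    rfl
  obtain ⟨hu, hv⟩ := List.append_inj hsplit (by rw [hlen, List.length_ofFn])
  have hleft : (fun i => σ (Fin.castAdd m i)) = S.orderEmbOfFin hk := by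
    refine Finset.orderEmbOfFin_unique hk (fun i => ?_) fun i j hij => ?_
    · rw [← mem_letters, ← hσ, PIX, pixedLeft_eq, hu, List.mem_toFinset, List.mem_ofFn]
      exact ⟨i, rfl⟩
    · have hp := pairwise_pixedPrefix (word σ)
      rw [hu, List.pairwise_ofFn] at hp
      refine lt_of_le_of_ne (Fin.le_def.2 (by simpa using hp hij)) fun e => hij.ne ?_
      simpa using σ.injective e
  have hex : ∀ x, ∃ y, Sᶜ.orderEmbOfFin hm y = σ (Fin.natAdd k x) := by
    intro x
    refine exists_orderEmbOfFin_eq hm (Finset.mem_compl.2 fun hS => ?_)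
    obtain ⟨i, hi⟩ := exists_orderEmbOfFin_eq hk hS
    rw [← hleft] at hi
    have := Fin.ext_iff.1 (σ.injective hi)
    rw [Fin.val_castAdd, Fin.val_natAdd] at this
    omega
  choose t ht using hex
  have hinj : Function.Injective t := fun x y h => by
    have := σ.injective ((ht x).symm.trans ((congrArg _ h).trans (ht y)))
    simpa using this
  have hglue : σ =
      glue hk hm (Equiv.ofBijective t (Finite.injective_iff_bijective.1 hinj)) := by
    refine Equiv.ext fun i => ?_
    refine Fin.addCases (fun i => ?_) (fun x => ?_) i
    · rw [glue_castAdd, ← hleft]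
    · rw [glue_natAdd, ← ht]; rfl
  refine ⟨_, ?_, hglue⟩
  have he := even_descRun_pixedSuffix (word σ)
  rw [hv] at he
  rw [pix_eq_zero_iff, ← descRun_ofFn_orderEmbOfFin hm]
  simp only [← ht] at he
  exact he

end glue

/-- The permutations with a given set of letters in the left factor of the pixed factorization
correspond to the desarrangements. -/
theorem card_PIX_eq {m : ℕ} {S : Finset (Fin n)} (hm : #Sᶜ = m) (P : List ℕ → Prop)
    [DecidablePred P] :
    #{σ : Equiv.Perm (Fin n) | PIX σ = letters S ∧ P (Desar σ)} =
      #{κ : Equiv.Perm (Fin m) | pix κ = 0 ∧ P (word κ)} := by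
  obtain ⟨k, hk⟩ : ∃ k, #S = k := ⟨_, rfl⟩
  obtain rfl : n = k + m := by
    have := Finset.card_add_card_compl S
    rw [Fintype.card_fin] at this
    omega
  symm
  refine Finset.card_bij (fun κ _ => glue hk hm κ) ?_ ?_ ?_
  · intro κ hκ
    rw [Finset.mem_filter_univ] at hκ ⊢
    rw [PIX_glue hk hm hκ.1, Desar_glue hk hm hκ.1]
    exact ⟨rfl, hκ.2⟩
  · intro κ hκ κ' hκ' h
    rw [Finset.mem_filter_univ] at hκ hκ'
    exact word_injective
      (by rw [← Desar_glue hk hm hκ.1, ← Desar_glue hk hm hκ'.1]; exact congrArg Desar h)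
  · intro σ hσ
    rw [Finset.mem_filter_univ] at hσ
    obtain ⟨κ, hκ, rfl⟩ := exists_eq_glue hk hm hσ.1
    rw [Desar_glue hk hm hκ] at hσ
    exact ⟨κ, by rw [Finset.mem_filter_univ]; exact ⟨hκ, hσ.2⟩, rfl⟩

theorem wordInverse_word (σ : Equiv.Perm (Fin n)) : wordInverse (word σ) = word σ⁻¹ := by
  rw [wordInverse, length_word]
  refine List.ext_getElem (by simp) fun i h1 h2 => ?_
  have hi : i < n := by simpa using h2
  have h3 : ((σ⁻¹ ⟨i, hi⟩ : Fin n) : ℕ) < (word σ).length := by simp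
  have h4 : (word σ)[((σ⁻¹ ⟨i, hi⟩ : Fin n) : ℕ)] = 1 + i := by
    simp [word, add_comm]
  have h5 := (nodup_word σ).idxOf_getElem _ h3
  rw [h4] at h5
  simp only [List.getElem_map, List.getElem_range', one_mul, h5]
  simp [word]

/-- The same function gives `DEZ` in the fixed decomposition and `IDES` in the pixed one. -/
theorem IDES_eq_insertDES (σ : Equiv.Perm (Fin n)) :
    IDES σ = insertDES n (PIX σ) (wordDES (wordInverse (Desar σ))) := by
  obtain ⟨S, hS⟩ := exists_eq_letters (PIX_subset σ)
  obtain ⟨k, hk⟩ : ∃ k, #S = k := ⟨_, rfl⟩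
  obtain ⟨m, hm⟩ : ∃ m, #Sᶜ = m := ⟨_, rfl⟩
  obtain rfl : n = k + m := by
    have := Finset.card_add_card_compl S
    rw [Fintype.card_fin] at this
    omega
  obtain ⟨κ, hκ, rfl⟩ := exists_eq_glue hk hm hS
  rw [IDES_glue, hS, Desar_glue hk hm hκ, wordInverse_word, IDES, DES]

/-! ### Inversions and the pixed decomposition -/

theorem wordInv_eq_zero {u : List ℕ} (hu : u.Pairwise (· ≤ ·)) : wordInv u = 0 := by
  induction u with
  | nil => rfl
  | cons x t ih =>
    rw [wordInv, ih hu.of_cons, add_zero, List.countP_eq_zero]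
    intro y hy
    simpa using List.rel_of_pairwise_cons hu hy

theorem wordInv_map {f : ℕ → ℕ} {v : List ℕ} (hf : ∀ x ∈ v, ∀ y ∈ v, f x < f y ↔ x < y) :
    wordInv (v.map f) = wordInv v := by
  induction v with
  | nil => rfl
  | cons x t ih =>
    rw [List.map_cons, wordInv, wordInv, List.countP_map,
      ih fun y hy z hz => hf y (by simp [hy]) z (by simp [hz])]
    congr 1
    refine List.countP_congr fun y hy => ?_
    simpa using hf y (by simp [hy]) x (by simp)

theorem red_lt_red_iff {A : Finset ℕ} {x y : ℕ} (hy : y ∈ A) :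
    red A x < red A y ↔ x < y := by
  constructor
  · intro h
    by_contra hle
    exact absurd (Finset.card_le_card (Finset.monotone_filter_right A
      fun a _ (ha : a ≤ y) => ha.trans (not_lt.1 hle))) h.not_ge
  · intro h
    refine Finset.card_lt_card (Finset.ssubset_iff_of_subset
      (Finset.monotone_filter_right A fun a _ (ha : a ≤ x) => ha.trans h.le) |>.2
        ⟨y, by simp [hy], by simp [h]⟩)

theorem sum_red (A : Finset ℕ) : ∑ a ∈ A, red A a = ∑ k ∈ Finset.Icc 1 #A, k := by
  induction A using Finset.induction_on_max with
  | empty => simp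
  | insert a s hs ih =>
    have ha : a ∉ s := fun h => lt_irrefl _ (hs a h)
    have h1 : red (insert a s) a = #s + 1 := by
      rw [red, Finset.filter_true_of_mem, Finset.card_insert_of_notMem ha]
      intro x hx
      rcases Finset.mem_insert.1 hx with rfl | hx
      · exact le_rfl
      · exact (hs x hx).le
    have h2 : ∀ b ∈ s, red (insert a s) b = red s b := fun b hb => by
      rw [red, Finset.filter_insert, if_neg (hs b hb).not_ge, red]
    rw [Finset.sum_insert ha, h1, Finset.sum_congr rfl h2, ih, Finset.card_insert_of_notMem ha,
      Finset.sum_Icc_succ_top (by omega), add_comm]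

theorem mem_word {σ : Equiv.Perm (Fin n)} {a : ℕ} : a ∈ word σ ↔ 1 ≤ a ∧ a ≤ n := by
  rw [word, List.mem_ofFn]
  constructor
  · rintro ⟨i, rfl⟩
    omega
  · rintro ⟨h1, h2⟩
    exact ⟨σ⁻¹ ⟨a - 1, by omega⟩, by simp; omega⟩

/-- The left factor of the pixed factorization is increasing, so the inversions are those of the
right factor and those between the two factors. -/
theorem inv_eq_excess_add (σ : Equiv.Perm (Fin n)) :
    inv σ = excess (PIX σ) + wordInv (Desar σ) := by
  have hword := pixedLeft_append_pixedRight σ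
  have hnodup := nodup_word σ
  rw [← hword] at hnodup
  obtain ⟨hu, hv, hdisj⟩ := List.nodup_append'.1 hnodup
  have hDesar : wordInv (Desar σ) = wordInv (pixedRight σ) :=
    wordInv_map fun x _ y hy => red_lt_red_iff (List.mem_toFinset.2 hy)
  have hsorted : wordInv (pixedLeft σ) = 0 := by
    rw [pixedLeft_eq]
    exact wordInv_eq_zero (pairwise_pixedPrefix _)
  -- the letters smaller than `x`, and `x` itself, are either in `PIX σ` or to its right
  have hcross : ∀ x ∈ PIX σ, (pixedRight σ).countP (· < x) + red (PIX σ) x = x := by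
    intro x hx
    have hx' := mem_word.1 (hword ▸ List.mem_append_left _ (List.mem_toFinset.1 hx))
    have h1 : (pixedRight σ).countP (· < x) = #{b ∈ (pixedRight σ).toFinset | b < x} := by
      rw [List.countP_eq_length_filter, ← List.toFinset_card_of_nodup (hv.filter _),
        List.toFinset_filter]
      simp
    rw [h1, red, ← Finset.card_union_of_disjoint]
    · have : {b ∈ (pixedRight σ).toFinset | b < x} ∪ {a ∈ PIX σ | a ≤ x} =
          Finset.Icc 1 x := by
        ext a
        have ha := mem_word (σ := σ) (a := a)
        rw [← hword, List.mem_append] at ha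
        simp only [Finset.mem_union, Finset.mem_filter, List.mem_toFinset, PIX, Finset.mem_Icc]
        constructor
        · rintro (⟨h, h'⟩ | ⟨h, h'⟩)
          · have := ha.1 (Or.inr h)
            omega
          · have := ha.1 (Or.inl h)
            omega
        · rintro ⟨h, h'⟩
          rcases ha.2 ⟨h, by omega⟩ with h3 | h3
          · exact Or.inr ⟨h3, h'⟩
          · refine Or.inl ⟨h3, lt_of_le_of_ne h' ?_⟩
            rintro rfl
            exact hdisj (List.mem_toFinset.1 hx) h3
      rw [this, Nat.card_Icc, Nat.add_sub_cancel]
    · rw [Finset.disjoint_left]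
      intro a ha hb
      exact hdisj (List.mem_toFinset.1 (Finset.mem_filter.1 hb).1)
        (List.mem_toFinset.1 (Finset.mem_filter.1 ha).1)
  have hsum := Finset.sum_congr rfl hcross
  rw [Finset.sum_add_distrib, sum_red, PIX, List.sum_toFinset _ hu, ← PIX] at hsum
  rw [← wordInv_word, ← hword, wordInv_append, hsorted, hDesar, excess]
  omega

/-! ### Equidistributed pairs of statistics -/

namespace Equidistributed

variable {α β : Type} [DecidableEq α] [DecidableEq β] {f g h : Equiv.Perm (Fin n) → α}

theorem symm (hfg : Equidistributed f g) : Equidistributed g f := fun v => (hfg v).symm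

theorem trans (hfg : Equidistributed f g) (hgh : Equidistributed g h) : Equidistributed f h :=
  fun v => (hfg v).trans (hgh v)

theorem comp (hfg : Equidistributed f g) (F : α → β) :
    Equidistributed (fun σ => F (f σ)) (fun σ => F (g σ)) := by
  intro y
  have hsum : ∀ k : Equiv.Perm (Fin n) → α,
      (∀ σ, k σ ∈ Finset.univ.image f ∪ Finset.univ.image g) →
      #{σ | F (k σ) = y} =
        ∑ v ∈ Finset.univ.image f ∪ Finset.univ.image g with F v = y, #{σ | k σ = v} := by
    intro k hk
    rw [Finset.card_eq_sum_card_fiberwise (f := k)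
      (t := {v ∈ Finset.univ.image f ∪ Finset.univ.image g | F v = y})]
    · refine Finset.sum_congr rfl fun v hv => ?_
      rw [Finset.filter_filter]
      congr 1
      refine Finset.filter_congr fun σ _ => ⟨fun h => h.2, fun h => ⟨?_, h⟩⟩
      rw [h]; exact (Finset.mem_filter.1 hv).2
    · intro σ hσ
      exact Finset.mem_filter.2 ⟨hk σ, (Finset.mem_filter.1 hσ).2⟩
  rw [hsum f fun σ => Finset.mem_union_left _ (Finset.mem_image_of_mem f (Finset.mem_univ σ)),
    hsum g fun σ => Finset.mem_union_right _ (Finset.mem_image_of_mem g (Finset.mem_univ σ))]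
  exact Finset.sum_congr rfl fun v _ => hfg v

theorem of_forall_prod {p q : Equiv.Perm (Fin n) → α} {p' q' : Equiv.Perm (Fin n) → β}
    (h : ∀ a b, #{σ | p σ = a ∧ p' σ = b} = #{σ | q σ = a ∧ q' σ = b}) :
    Equidistributed (fun σ => (p σ, p' σ)) (fun σ => (q σ, q' σ)) := by
  rintro ⟨a, b⟩
  simpa only [Prod.mk.injEq] using h a b

end Equidistributed

theorem equidistributed_fix_DES :
    Equidistributed (fun σ : Equiv.Perm (Fin n) => (fix σ, DES σ))
      (fun σ => (pix σ, IDES σ)) :=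
  .of_forall_prod card_fix_DES_eq_card_pix_IDES

/-- Since `pix` is a function of `DES`, this is a coarsening of the Foata-Schützenberger theorem. -/
theorem equidistributed_pix_inv :
    Equidistributed (fun σ : Equiv.Perm (Fin n) => (pix σ, inv σ))
      (fun σ => (pix σ, imaj σ)) := by
  have h : Equidistributed (fun σ : Equiv.Perm (Fin n) => (inv σ, DES σ))
      (fun σ => (imaj σ, DES σ)) := .of_forall_prod card_inv_DES_eq_card_imaj_DES
  have hpix : ∀ σ : Equiv.Perm (Fin n), Function.extend DES pix 0 (DES σ) = pix σ :=
    Function.FactorsThrough.extend_apply (fun _ _ h => pix_congr h) 0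
  have := h.comp fun p => (Function.extend (DES (n := n)) pix 0 p.2, p.1)
  simpa only [hpix] using this

theorem equidistributed_FIX_Der :
    Equidistributed (fun σ : Equiv.Perm (Fin n) => (FIX σ, wordDES (Der σ)))
      (fun σ => (PIX σ, wordDES (wordInverse (Desar σ)))) := by
  refine .of_forall_prod fun A E => ?_
  by_cases hA : A ⊆ Finset.Icc 1 n
  · obtain ⟨S, rfl⟩ := exists_eq_letters hA
    rw [card_FIX_eq (S := S) rfl fun w => wordDES w = E,
      card_PIX_eq (S := S) rfl fun w => wordDES (wordInverse w) = E]
    simp only [wordInverse_word]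
    exact card_fix_DES_eq_card_pix_IDES 0 E
  · rw [Finset.filter_false_of_mem, Finset.filter_false_of_mem]
    · exact fun σ _ h => hA (h.1 ▸ PIX_subset σ)
    · exact fun σ _ h => hA (h.1 ▸ FIX_subset σ)

theorem equidistributed_PIX_Desar :
    Equidistributed (fun σ : Equiv.Perm (Fin n) => (PIX σ, wordMaj (wordInverse (Desar σ))))
      (fun σ => (PIX σ, wordInv (Desar σ))) := by
  refine .of_forall_prod fun A v => ?_
  by_cases hA : A ⊆ Finset.Icc 1 n
  · obtain ⟨S, rfl⟩ := exists_eq_letters hA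
    rw [card_PIX_eq (S := S) rfl fun w => wordMaj (wordInverse w) = v,
      card_PIX_eq (S := S) rfl fun w => wordInv w = v]
    simp only [wordInverse_word, wordInv_word]
    have h := (equidistributed_pix_inv (n := #Sᶜ) (0, v)).symm
    simp only [Prod.mk.injEq] at h
    exact h
  · rw [Finset.filter_false_of_mem, Finset.filter_false_of_mem] <;>
      exact fun σ _ h => hA (h.1 ▸ PIX_subset σ)

theorem equidistributed_FIX_DEZ :
    Equidistributed (fun σ : Equiv.Perm (Fin n) => (FIX σ, DEZ σ))
      (fun σ => (PIX σ, IDES σ)) := by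
  simpa only [DEZ_eq_insertDES, IDES_eq_insertDES] using
    equidistributed_FIX_Der.comp fun p => (p.1, insertDES n p.1 p.2)

theorem equidistributed_FIX_maf :
    Equidistributed (fun σ : Equiv.Perm (Fin n) => (FIX σ, maf σ))
      (fun σ => (PIX σ, mag σ)) :=
  equidistributed_FIX_Der.comp fun p => (p.1, excess p.1 + ∑ i ∈ p.2, i)

theorem equidistributed_PIX_mag :
    Equidistributed (fun σ : Equiv.Perm (Fin n) => (PIX σ, mag σ))
      (fun σ => (PIX σ, inv σ)) := by
  have h := (equidistributed_PIX_Desar (n := n)).comp fun p => (p.1, excess p.1 + p.2)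
  simp only [← inv_eq_excess_add] at h
  exact h

end FixMahonian

open FixMahonian
theorem theorem1p2 (n : ℕ) :
    List.Pairwise Equidistributed
      [fun σ : Equiv.Perm (Fin n) => (fix σ, maj σ),
       fun σ => (fix σ, maf σ),
       fun σ => (fix σ, maz σ),
       fun σ => (pix σ, mag σ),
       fun σ => (pix σ, inv σ),
       fun σ => (pix σ, imaj σ)] ∧
    List.Pairwise Equidistributed
      [fun σ : Equiv.Perm (Fin n) => (FIX σ, maf σ),
       fun σ => (PIX σ, mag σ),
       fun σ => (PIX σ, inv σ)] ∧
    List.Pairwise Equidistributed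
      [fun σ : Equiv.Perm (Fin n) => (fix σ, DEZ σ),
       fun σ => (fix σ, DES σ),
       fun σ => (pix σ, IDES σ)] ∧
    Equidistributed
      (fun σ : Equiv.Perm (Fin n) => (FIX σ, DEZ σ))
      (fun σ => (PIX σ, IDES σ)) := by
  have hDEZ : Equidistributed (fun σ : Equiv.Perm (Fin n) => (fix σ, DEZ σ))
      (fun σ => (pix σ, IDES σ)) := equidistributed_FIX_DEZ.comp fun p => (#p.1, p.2)
  have hmaj : Equidistributed (fun σ : Equiv.Perm (Fin n) => (fix σ, maj σ))
      (fun σ => (pix σ, imaj σ)) :=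
    equidistributed_fix_DES.comp fun p => (p.1, ∑ i ∈ p.2, i)
  have hmaz : Equidistributed (fun σ : Equiv.Perm (Fin n) => (fix σ, maz σ))
      (fun σ => (pix σ, imaj σ)) := hDEZ.comp fun p => (p.1, ∑ i ∈ p.2, i)
  have hinv := equidistributed_pix_inv (n := n)
  have hmag : Equidistributed (fun σ : Equiv.Perm (Fin n) => (pix σ, mag σ))
      (fun σ => (pix σ, imaj σ)) :=
    (equidistributed_PIX_mag.comp fun p => (#p.1, p.2)).trans hinv
  have hmaf : Equidistributed (fun σ : Equiv.Perm (Fin n) => (fix σ, maf σ))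
      (fun σ => (pix σ, imaj σ)) :=
    (equidistributed_FIX_maf.comp fun p => (#p.1, p.2)).trans hmag
  refine ⟨?_, ?_, ?_, equidistributed_FIX_DEZ⟩
  · simp only [List.pairwise_cons, List.mem_cons, List.not_mem_nil, or_false, forall_eq_or_imp,
      forall_eq, false_imp_iff, implies_true, and_true, List.Pairwise.nil]
    exact ⟨⟨hmaj.trans hmaf.symm, hmaj.trans hmaz.symm, hmaj.trans hmag.symm,
      hmaj.trans hinv.symm, hmaj⟩, ⟨hmaf.trans hmaz.symm, hmaf.trans hmag.symm,
      hmaf.trans hinv.symm, hmaf⟩, ⟨hmaz.trans hmag.symm, hmaz.trans hinv.symm, hmaz⟩,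
      ⟨hmag.trans hinv.symm, hmag⟩, hinv⟩
  · simp only [List.pairwise_cons, List.mem_cons, List.not_mem_nil, or_false, forall_eq_or_imp,
      forall_eq, false_imp_iff, implies_true, and_true, List.Pairwise.nil]
    exact ⟨⟨equidistributed_FIX_maf, equidistributed_FIX_maf.trans equidistributed_PIX_mag⟩,
      equidistributed_PIX_mag⟩
  · simp only [List.pairwise_cons, List.mem_cons, List.not_mem_nil, or_false, forall_eq_or_imp,
      forall_eq, false_imp_iff, implies_true, and_true, List.Pairwise.nil]
    exact ⟨⟨hDEZ.trans equidistributed_fix_DES.symm, hDEZ⟩, equidistributed_fix_DES⟩
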